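/- Let $M$ be a smooth finite-dimensional manifold (Hausdorff, second countable, without boundary) with a Finsler metric $F\colon TM\to[0,\infty)$: $F$ is continuous, vanishes exactly on the zero section, satisfies $F(x,\lambda y)=\lambda F(x,y)$ for $\lambda>0$, $F(x,\cdot)^2$ is $C^2$ off the origin for every $x$, and the fundamental tensor $g_{ij}(x,y)=\frac12\frac{\partial^2F^2}{\partial y^i\partial y^j}(x,y)$ is positive definite and of class $C^{1,1}_{\rm loc}$ on $TM\setminus 0$ (its components in coordinates are $C^1$ with locally Lipschitz derivatives). $F$ need not be reversible; $\tilde F(x,y)=F(x,-y)$ is the reversed metric. A geodesic is a curve that is either constant or regular (nowhere vanishing velocity), twice differentiable and in local coordinates a solution of $$g_{ij}(\gamma,\dot\gamma)\,\ddot\gamma^i+\tfrac12\,\partial_{y^jx^k}F^2(\gamma,\dot\gamma)\,\dot\gamma^k-\tfrac12\,\partial_{x^j}F^2(\gamma,\dot\gamma)=0\quad\text{for all } j .$$ For $y\in T_xM$, $\exp_x(y)=\gamma(1)$, where $\gamma\colon[0,1]\to M$ is the geodesic of $F$ with $\gamma(0)=x$, $\dot\gamma(0)=y$ (if it is defined on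 $[0,1]$); $\widetilde\exp$ is the exponential map of $\tilde F$. Let $D\subset M$ be a $C^{2,1}_{\rm loc}$ domain: $D$ is open, non-empty and connected, and every $x\in\partial D$ has an open neighbourhood $U$ with a defining function, that is, a $C^{2,1}_{\rm loc}$ function $\phi\colon U\to\mathbb R$ with $\phi^{-1}(0)=U\cap\partial D$, $\phi>0$ on $U\cap D$ and $d\phi\neq0$ on $U\cap\partial D$. Then $T_x\partial D=\ker d\phi(x)$ for $x\in U\cap\partial D$. For $y\neq0$ put $H_\phi(x,y)[y,y]=\frac{d^2}{ds^2}(\phi\circ\gamma)(0)$, where $\gamma$ is the geodesic of $F$ with $\gamma(0)=x$, $\dot\gamma(0)=y$. Then the following are equivalent: (a) $\partial D$ is infinitesimally convex: for every $x\in\partial D$, every defining function $\phi$ near $x$ and every nonzero $y\in T_x\partial D$, $H_\phi(x,y)[y,y]\le 0$; (b) $\partial D$ is geometrically convex: every geodesic $\gamma\colon[a,b]\to\overline D$ of $F$ with $\gamma(a),\gamma(b)\in D$ satisfies $\gamma([a,b])\subset D$; (c) $\partial D$ is locally convex: for every $x\in\partial D$ there is a neighbourhood $N$ of $0$ in $T_xM$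 such that neither $\exp_x$ nor $\widetilde\exp_x$ takes a value in $D$ on $N\cap T_x\partial D$; (c$'$) the condition in (c) holds for $\exp$ alone. -/

import Mathlib

open Set Filter Topology
open scoped Manifold ContDiff

noncomputable section

namespace FinslerConvexity

section Regularity

variable {V W : Type*} [NormedAddCommGroup V] [NormedSpace ℝ V]
  [NormedAddCommGroup W] [NormedSpace ℝ W]

/-- `f` is of class `C^{1,1}_loc` on the open set `S`. -/
def C11On (f : V → W) (S : Set V) : Prop :=
  ContDiffOn ℝ 1 f S ∧ LocallyLipschitzOn S (fderiv ℝ f)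

/-- `f` is of class `C^{2,1}_loc` on the open set `S`. -/
def C21On (f : V → W) (S : Set V) : Prop :=
  ContDiffOn ℝ 2 f S ∧ LocallyLipschitzOn S (fderiv ℝ (fderiv ℝ f))

end Regularity

variable {E : Type*} [NormedAddCommGroup E] [NormedSpace ℝ E]
  {M : Type*} [TopologicalSpace M] [ChartedSpace E M]

/-- The square of `F` in the coordinates of `TM` induced by the chart `e`:
`(u, v) ↦ F² (x, y)`, where `x` has coordinates `u` and `y ∈ T_x M` has components `v`. -/
def sqInChart (F : (x : M) → TangentSpace 𝓘(ℝ, E) x → ℝ) (e : OpenPartialHomeomorph M E)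
    (u v : E) : ℝ :=
  F (e.symm u) (mfderiv 𝓘(ℝ, E) 𝓘(ℝ, E) e.symm u v) ^ 2

/-- The fundamental tensor `g = ½ ∂²F² / ∂y∂y` in the chart `e`, as a bilinear form. -/
def fundamentalTensor (F : (x : M) → TangentSpace 𝓘(ℝ, E) x → ℝ) (e : OpenPartialHomeomorph M E)
    (u v : E) : E →L[ℝ] E →L[ℝ] ℝ :=
  (1 / 2 : ℝ) • fderiv ℝ (fun w => fderiv ℝ (fun z => sqInChart F e u z) w) v

/-- `F` is a Finsler metric on `M` whose fundamental tensor is `C^{1,1}_loc` on `TM ∖ 0`. -/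
structure IsFinslerMetric [IsManifold 𝓘(ℝ, E) ∞ M] (F : (x : M) → TangentSpace 𝓘(ℝ, E) x → ℝ) : Prop where
  nonneg : ∀ x y, 0 ≤ F x y
  eq_zero_iff : ∀ x y, F x y = 0 ↔ y = 0
  homogeneous : ∀ x y (c : ℝ), 0 < c → F x (c • y) = c * F x y
  continuous : Continuous (fun p : TangentBundle 𝓘(ℝ, E) M => F p.proj p.snd)
  contDiffOn_fiber : ∀ e ∈ atlas E M, ∀ u ∈ e.target,
    ContDiffOn ℝ 2 (fun v => sqInChart F e u v) {0}ᶜ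
  posDef : ∀ e ∈ atlas E M, ∀ u ∈ e.target, ∀ v : E, v ≠ 0 → ∀ w : E, w ≠ 0 →
    0 < fundamentalTensor F e u v w w
  c11 : ∀ e ∈ atlas E M,
    C11On (fun p : E × E => fundamentalTensor F e p.1 p.2) (e.target ×ˢ ({0}ᶜ : Set E))

/-- The reversed metric `(x, y) ↦ F (x, -y)`. -/
def reversed (F : (x : M) → TangentSpace 𝓘(ℝ, E) x → ℝ) :
    (x : M) → TangentSpace 𝓘(ℝ, E) x → ℝ :=
  fun x y => F x (-y)

/-- The geodesic equation in the chart `e` at position `u`, velocity `v`, acceleration `a`: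
`g_{ij} a^i + ½ ∂²F²/∂y^j∂x^k v^k - ½ ∂F²/∂x^j = 0` for all `j`
(contracted with an arbitrary vector `w`, instead of written by components). -/
def GeodesicEquation (F : (x : M) → TangentSpace 𝓘(ℝ, E) x → ℝ) (e : OpenPartialHomeomorph M E)
    (u v a : E) : Prop :=
  ∀ w : E, fundamentalTensor F e u v a w
    + 1 / 2 * fderiv ℝ (fun u' => fderiv ℝ (fun z => sqInChart F e u' z) v w) u v
    - 1 / 2 * fderiv ℝ (fun u' => sqInChart F e u' v) u w = 0

/-- `γ` is a (constant speed) geodesic of `F` on the interval `J`: either it is constant, or it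
is regular and, in local coordinates around each of its points, twice differentiable and a
solution of the geodesic equation. Derivatives are one-sided at end points that belong to `J`. -/
def IsGeodesicOn (F : (x : M) → TangentSpace 𝓘(ℝ, E) x → ℝ) (γ : ℝ → M) (J : Set ℝ) : Prop :=
  (∃ p, ∀ t ∈ J, γ t = p) ∨
  ∀ t₀ ∈ J, ∃ e ∈ atlas E M, ∃ v a : ℝ → E, ∀ᶠ t in 𝓝[J] t₀,
    γ t ∈ e.source ∧
    HasDerivWithinAt (fun s => e (γ s)) (v t) J t ∧
    HasDerivWithinAt v (a t) J t ∧
    v t ≠ 0 ∧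
    GeodesicEquation F e (e (γ t)) (v t) (a t)

/-- The velocity of `γ` at time `t`, as a point of the tangent bundle; the derivative is taken
within `J`. -/
def velocity (E : Type*) [NormedAddCommGroup E] [NormedSpace ℝ E] {M : Type*}
    [TopologicalSpace M] [ChartedSpace E M] (γ : ℝ → M) (J : Set ℝ) (t : ℝ) :
    TangentBundle 𝓘(ℝ, E) M :=
  ⟨γ t, mfderivWithin 𝓘(ℝ, ℝ) 𝓘(ℝ, E) γ J t (1 : ℝ)⟩

/-- `q = exp_x y` for the exponential map of `F`: the geodesic of `F` with initial point `x` and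
initial velocity `y` is defined on `[0, 1]` and takes the value `q` at time `1`. -/
def IsExp (F : (x : M) → TangentSpace 𝓘(ℝ, E) x → ℝ) (x : M) (y : TangentSpace 𝓘(ℝ, E) x)
    (q : M) : Prop :=
  ∃ γ : ℝ → M, IsGeodesicOn F γ (Icc 0 1) ∧ velocity E γ (Icc 0 1) 0 = ⟨x, y⟩ ∧ γ 1 = q

/-- `h = H_φ(x, y)[y, y]`, the Finslerian Hessian of `φ`: the second derivative at `0` of
`φ ∘ γ`, for the geodesic `γ` of `F` with `γ(0) = x` and `γ'(0) = y`. -/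
def IsHessian (F : (x : M) → TangentSpace 𝓘(ℝ, E) x → ℝ) (φ : M → ℝ) (x : M)
    (y : TangentSpace 𝓘(ℝ, E) x) (h : ℝ) : Prop :=
  ∃ (ε : ℝ) (γ : ℝ → M), 0 < ε ∧ IsGeodesicOn F γ (Ioo (-ε) ε) ∧
    velocity E γ (Ioo (-ε) ε) 0 = ⟨x, y⟩ ∧ deriv (deriv (fun s => φ (γ s))) 0 = h

/-- `φ` (considered on `U` only) is a `C^{2,1}_loc` defining function for `∂D` on the open
set `U`: `φ⁻¹(0) = U ∩ ∂D`, `φ > 0` on `U ∩ D` and `dφ ≠ 0` on `U ∩ ∂D`. -/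
structure IsDefiningFunction (E : Type*) [NormedAddCommGroup E] [NormedSpace ℝ E] {M : Type*}
    [TopologicalSpace M] [ChartedSpace E M] (D U : Set M) (φ : M → ℝ) : Prop where
  isOpen : IsOpen U
  c21 : ∀ e ∈ atlas E M, C21On (fun u => φ (e.symm u)) (e.target ∩ e.symm ⁻¹' U)
  eq_zero_iff : ∀ x ∈ U, φ x = 0 ↔ x ∈ frontier D
  pos : ∀ x ∈ U ∩ D, 0 < φ x
  regular : ∀ x ∈ U ∩ frontier D, mfderiv 𝓘(ℝ, E) 𝓘(ℝ, ℝ) φ x ≠ 0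

/-- `D` is a `C^{2,1}_loc` domain: open, connected, and with a `C^{2,1}_loc` defining function
around each point of its boundary. -/
structure IsC21Domain (E : Type*) [NormedAddCommGroup E] [NormedSpace ℝ E] {M : Type*}
    [TopologicalSpace M] [ChartedSpace E M] (D : Set M) : Prop where
  isOpen : IsOpen D
  isConnected : IsConnected D
  exists_defining : ∀ x ∈ frontier D, ∃ U φ, x ∈ U ∧ IsDefiningFunction E D U φ

/-- The tangent space `T_x ∂D = ker dφ(x)`, where `φ` is a defining function for `∂D` on a
neighbourhood of `x ∈ ∂D` (all defining functions have the same kernel). -/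
def boundaryTangent (E : Type*) [NormedAddCommGroup E] [NormedSpace ℝ E] {M : Type*}
    [TopologicalSpace M] [ChartedSpace E M] (φ : M → ℝ) (x : M) :
    Set (TangentSpace 𝓘(ℝ, E) x) :=
  {y | mfderiv 𝓘(ℝ, E) 𝓘(ℝ, ℝ) φ x y = 0}

/-- `∂D` is infinitesimally convex: `H_φ(x, y)[y, y] ≤ 0` for all `x ∈ ∂D` and all nonzero
`y ∈ T_x ∂D`, for the functions `φ` that define `∂D` near `x`. -/
def InfinitesimallyConvex (F : (x : M) → TangentSpace 𝓘(ℝ, E) x → ℝ) (D : Set M) : Prop :=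
  ∀ x ∈ frontier D, ∀ U φ, x ∈ U → IsDefiningFunction E D U φ →
    ∀ y ∈ boundaryTangent E φ x, y ≠ 0 → ∃ h ≤ 0, IsHessian F φ x y h

/-- `∂D` is geometrically convex: every geodesic of the closure of `D` with end points in `D`
is contained in `D`. -/
def GeometricallyConvex (F : (x : M) → TangentSpace 𝓘(ℝ, E) x → ℝ) (D : Set M) : Prop :=
  ∀ (a b : ℝ) (γ : ℝ → M), a ≤ b → IsGeodesicOn F γ (Icc a b) →
    (∀ t ∈ Icc a b, γ t ∈ closure D) → γ a ∈ D → γ b ∈ D → ∀ t ∈ Icc a b, γ t ∈ D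

/-- For every `x ∈ ∂D`, the exponential map of `F` at `x`, restricted to a small enough
neighbourhood of `0` in `T_x ∂D`, does not take values in `D`. -/
def ForwardLocallyConvex (F : (x : M) → TangentSpace 𝓘(ℝ, E) x → ℝ) (D : Set M) : Prop :=
  ∀ x ∈ frontier D, ∀ U φ, x ∈ U → IsDefiningFunction E D U φ →
    ∃ N ∈ 𝓝 (0 : TangentSpace 𝓘(ℝ, E) x), ∀ y ∈ N ∩ boundaryTangent E φ x,
      ∀ q, IsExp F x y q → q ∉ D

/-- `∂D` is locally convex: the condition above holds for the exponential maps of `F` and of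
the reversed metric. -/
def LocallyConvex (F : (x : M) → TangentSpace 𝓘(ℝ, E) x → ℝ) (D : Set M) : Prop :=
  ForwardLocallyConvex F D ∧ ForwardLocallyConvex (reversed F) D

end FinslerConvexity

end

/-!
In a chart, the square of a Finsler metric is a Lagrangian `L (u, v)`, homogeneous of degree two in
the velocity `v`. Euler's relations express `L` and the momentum `∂L/∂v` by the fundamental tensor,
so both are `C¹` with locally Lipschitz derivatives off the zero section, and the geodesic equation
takes the form `a = accel L (u, v)` with a locally Lipschitz right-hand side. It does not depend on
the chart (`eulerLagrange_change_iff`). The Hessian of a defining function `φ` is then the locally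
Lipschitz function `hessianForm L φ (u, v) = D²φ(v, v) + Dφ(accel L (u, v))`, and no uniqueness of
geodesics is needed to identify it (`IsHessian.eq_hessianForm`).

If the Hessian is positive on some vector tangent to the boundary, then `φ` is positive along the
geodesic in that direction except at its initial point, and the geodesic runs inside the domain
(`exists_solution_mem_domain`; near a boundary point the domain is all of `{φ > 0}`). Over a short
interval around the initial time, this geodesic contradicts geometric convexity; run at low speed,
it contradicts local convexity, already for `exp` alone.

Conversely, let the boundary be infinitesimally convex. A pair `(u, v)` is at a distance at most a
constant times `|φ(u)| + |Dφ(v)|` from a vector tangent to the boundary (metric regularity,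
`exists_zero_near`), where the Hessian is nonpositive. Since the Hessian is locally Lipschitz and
homogeneous, it is at most `C (|φ(u)| ‖v‖² + |Dφ(v)| ‖v‖)` near a boundary point
(`exists_hessianForm_le`); this is where `C^{1,1}` and `C^{2,1}` regularity are used. Thus
`f = φ ∘ γ`, for a geodesic `γ`, satisfies `f'' ≤ A |f| + B |f'|`, and if `f` and `f'` vanish at the
initial time then `f ≤ 0` for some time (`nonpos_of_second_deriv_le`). Applied where a geodesic of
the closure first touches the boundary, this keeps the geodesic in the boundary ever after
(`eventually_mem_frontier`), so it cannot end in the domain. Applied to geodesics with small initial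
velocity tangent to the boundary, which stay near their initial point (`exists_velocity_bound`), it
gives local convexity for `exp`. Infinitesimal convexity is the same condition for the reversed
metric, because the boundary has the tangent vector `-y` whenever it has `y`; this gives local
convexity for the exponential map of the reversed metric.
-/

noncomputable section

-- for the instances on the threefold iterated spaces of linear maps in which the derivative of the
-- fundamental tensor lives
set_option maxSynthPendingDepth 3

namespace FinslerConvexity

/-! ### Locally Lipschitz functions -/

section Lipschitz

variable {V W X : Type*} [PseudoMetricSpace V] [PseudoMetricSpace W] [PseudoMetricSpace X]

/-- `f` is Lipschitz on some neighbourhood of `x`. -/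
def LipschitzNear (f : V → W) (x : V) : Prop :=
  ∃ K : NNReal, ∃ t ∈ 𝓝 x, LipschitzOnWith K f t

theorem LocallyLipschitzOn.lipschitzNear {f : V → W} {S : Set V} (hf : LocallyLipschitzOn S f)
    (hS : IsOpen S) {x : V} (hx : x ∈ S) : LipschitzNear f x := by
  obtain ⟨K, t, ht, h⟩ := hf hx
  exact ⟨K, t, by rwa [hS.nhdsWithin_eq hx] at ht, h⟩

theorem LipschitzNear.locallyLipschitzOn {f : V → W} {S : Set V}
    (hf : ∀ x ∈ S, LipschitzNear f x) : LocallyLipschitzOn S f := by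
  intro x hx
  obtain ⟨K, t, ht, h⟩ := hf x hx
  exact ⟨K, t, mem_nhdsWithin_of_mem_nhds ht, h⟩

namespace LipschitzNear

theorem continuousAt {f : V → W} {x : V} (hf : LipschitzNear f x) : ContinuousAt f x := by
  obtain ⟨K, t, ht, h⟩ := hf
  exact h.continuousOn.continuousAt ht

theorem prodMk {f : V → W} {g : V → X} {x : V} (hf : LipschitzNear f x)
    (hg : LipschitzNear g x) : LipschitzNear (fun y => (f y, g y)) x := by
  obtain ⟨K, t, ht, h⟩ := hf
  obtain ⟨K', t', ht', h'⟩ := hg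
  exact ⟨max K K', t ∩ t', inter_mem ht ht',
    (h.mono inter_subset_left).prodMk (h'.mono inter_subset_right)⟩

theorem comp {g : W → X} {f : V → W} {x : V} (hg : LipschitzNear g (f x))
    (hf : LipschitzNear f x) : LipschitzNear (fun y => g (f y)) x := by
  have hc := hf.continuousAt
  obtain ⟨K, t, ht, h⟩ := hf
  obtain ⟨K', t', ht', h'⟩ := hg
  exact ⟨K' * K, t ∩ f ⁻¹' t', inter_mem ht (hc ht'),
    h'.comp (h.mono inter_subset_left) fun y hy => hy.2⟩

theorem congr {f g : V → W} {x : V} (hf : LipschitzNear f x) (h : f =ᶠ[𝓝 x] g) :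
    LipschitzNear g x := by
  obtain ⟨K, t, ht, hK⟩ := hf
  refine ⟨K, t ∩ {y | f y = g y}, inter_mem ht h, fun y hy z hz => ?_⟩
  have h1 : f y = g y := hy.2
  have h2 : f z = g z := hz.2
  rw [← h1, ← h2]
  exact hK hy.1 hz.1

end LipschitzNear

end Lipschitz

theorem ContDiffAt.lipschitzNear {V W : Type*} [NormedAddCommGroup V] [NormedSpace ℝ V]
    [NormedAddCommGroup W] [NormedSpace ℝ W] {f : V → W} {x : V} (hf : ContDiffAt ℝ 1 f x) :
    LipschitzNear f x :=
  hf.exists_lipschitzOnWith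

theorem LipschitzNear.clm_apply {V W X : Type*} [PseudoMetricSpace V]
    [NormedAddCommGroup W] [NormedSpace ℝ W] [NormedAddCommGroup X] [NormedSpace ℝ X]
    {f : V → W →L[ℝ] X} {g : V → W} {x : V} (hf : LipschitzNear f x)
    (hg : LipschitzNear g x) : LipschitzNear (fun y => f y (g y)) x := by
  have : ContDiff ℝ 1 (fun q : (W →L[ℝ] X) × W => q.1 q.2) := by fun_prop
  exact LipschitzNear.comp (f := fun y => (f y, g y))
    (ContDiffAt.lipschitzNear this.contDiffAt) (hf.prodMk hg)

/-! ### Lagrangians of Finsler type -/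

section Lagrangian

variable {E : Type*} [NormedAddCommGroup E] [NormedSpace ℝ E]

/-- Half the second vertical derivative of a Lagrangian `L`. -/
def tensor (L : E → E → ℝ) (u v : E) : E →L[ℝ] E →L[ℝ] ℝ :=
  (1 / 2 : ℝ) • fderiv ℝ (fun w => fderiv ℝ (fun z => L u z) w) v

/-- The Euler--Lagrange equation of `L`, at position `u`, velocity `v`, acceleration `a`. -/
def EulerLagrange (L : E → E → ℝ) (u v a : E) : Prop :=
  ∀ w : E, tensor L u v a w
    + 1 / 2 * fderiv ℝ (fun u' => fderiv ℝ (fun z => L u' z) v w) u v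
    - 1 / 2 * fderiv ℝ (fun u' => L u' v) u w = 0

/-- `L` has the properties, over the open set `T`, of the square of a Finsler metric written in a
chart with range `T`. -/
structure IsFinslerLagrangian (L : E → E → ℝ) (T : Set E) : Prop where
  isOpen : IsOpen T
  homogeneous : ∀ u v (c : ℝ), 0 < c → L u (c • v) = c ^ 2 * L u v
  contDiffOn_fiber : ∀ u ∈ T, ContDiffOn ℝ 2 (fun v => L u v) {0}ᶜ
  posDef : ∀ u ∈ T, ∀ v : E, v ≠ 0 → ∀ w : E, w ≠ 0 → 0 < tensor L u v w w
  c11 : C11On (fun p : E × E => tensor L p.1 p.2) (T ×ˢ ({0}ᶜ : Set E))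

/-- The momentum, that is, the vertical derivative of `L`, as a function on the tangent bundle. -/
def momentum (L : E → E → ℝ) (p : E × E) : E →L[ℝ] ℝ := fderiv ℝ (L p.1) p.2

/-- The acceleration of the solution of the Euler--Lagrange equation with position `p.1` and
velocity `p.2`; it is meaningful where `tensor L p.1 p.2` is invertible. -/
def accel (L : E → E → ℝ) (p : E × E) : E :=
  (tensor L p.1 p.2).inverse ((1 / 2 : ℝ) •
    ((fderiv ℝ (fun q : E × E => L q.1 q.2) p).comp (ContinuousLinearMap.inl ℝ E E)
      - fderiv ℝ (momentum L) p (p.2, 0)))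

theorem fderiv_fun_const_smul_real {V W : Type*} [NormedAddCommGroup V] [NormedSpace ℝ V]
    [NormedAddCommGroup W] [NormedSpace ℝ W] (c : ℝ) (f : V → W) (x : V) :
    fderiv ℝ (fun y => c • f y) x = c • fderiv ℝ f x := by
  simpa using! congrFun (fderiv_const_smul_field (𝕜 := ℝ) (f := f) c) x

namespace IsFinslerLagrangian

variable {L : E → E → ℝ} {T : Set E} (hL : IsFinslerLagrangian L T)
include hL

theorem isOpen_prod : IsOpen (T ×ˢ ({0}ᶜ : Set E)) :=
  hL.isOpen.prod isOpen_compl_singleton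

theorem fderiv_smul (u v : E) {c : ℝ} (hc : 0 < c) :
    fderiv ℝ (L u) (c • v) = c • fderiv ℝ (L u) v := by
  have h1 : fderiv ℝ (fun z => L u (c • z)) v = c ^ 2 • fderiv ℝ (L u) v := by
    have : (fun z => L u (c • z)) = fun z => c ^ 2 • L u z := by
      ext z; exact hL.homogeneous u z c hc
    rw [this]
    exact fderiv_fun_const_smul_real _ _ _
  have h2 := fderiv_comp_smul (𝕜 := ℝ) (f := L u) (c := c) (x := v)
  rw [h1] at h2
  have := congrArg (fun l => c⁻¹ • l) h2
  simp only [smul_smul] at this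
  rw [inv_mul_cancel₀ hc.ne', one_smul] at this
  rw [← this]
  congr 1
  field_simp

/-- Euler's relation for the momentum, which is homogeneous of degree one. -/
theorem tensor_apply_self {u v : E} (hu : u ∈ T) (hv : v ≠ 0) :
    tensor L u v v = (1 / 2 : ℝ) • fderiv ℝ (L u) v := by
  have hd : DifferentiableAt ℝ (fderiv ℝ (L u)) v := by
    have := (hL.contDiffOn_fiber u hu).contDiffAt (isOpen_compl_singleton.mem_nhds hv)
    exact (this.fderiv_right (m := 1) (by norm_num)).differentiableAt (by norm_num)
  have h1 : HasDerivAt (fun c : ℝ => c • v) v 1 := by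
    simpa using (hasDerivAt_id (1 : ℝ)).smul_const v
  have h2 : HasDerivAt (fun c : ℝ => fderiv ℝ (L u) (c • v)) (fderiv ℝ (fderiv ℝ (L u)) v v) 1 := by
    have hd' : HasFDerivAt (fderiv ℝ (L u)) (fderiv ℝ (fderiv ℝ (L u)) v) ((1 : ℝ) • v) := by
      simpa using hd.hasFDerivAt
    exact hd'.comp_hasDerivAt (1 : ℝ) h1
  have h3 : HasDerivAt (fun c : ℝ => c • fderiv ℝ (L u) v) (fderiv ℝ (L u) v) 1 := by
    simpa using (hasDerivAt_id (1 : ℝ)).smul_const (fderiv ℝ (L u) v)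
  have h4 : (fun c : ℝ => fderiv ℝ (L u) (c • v)) =ᶠ[𝓝 1] fun c : ℝ => c • fderiv ℝ (L u) v := by
    filter_upwards [lt_mem_nhds (zero_lt_one)] with c hc using hL.fderiv_smul u v hc
  have h5 := h2.unique (h3.congr_of_eventuallyEq h4)
  change (1 / 2 : ℝ) • fderiv ℝ (fderiv ℝ (L u)) v v = _
  rw [h5]

/-- Euler's relation for `L`, which is homogeneous of degree two. -/
theorem fderiv_apply_self {u v : E} (hu : u ∈ T) (hv : v ≠ 0) :
    fderiv ℝ (L u) v v = 2 * L u v := by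
  have hd : DifferentiableAt ℝ (L u) v :=
    ((hL.contDiffOn_fiber u hu).contDiffAt (isOpen_compl_singleton.mem_nhds hv)).differentiableAt
      (by norm_num)
  have h1 : HasDerivAt (fun c : ℝ => c • v) v 1 := by
    simpa using (hasDerivAt_id (1 : ℝ)).smul_const v
  have h2 : HasDerivAt (fun c : ℝ => L u (c • v)) (fderiv ℝ (L u) v v) 1 := by
    have hd' : HasFDerivAt (L u) (fderiv ℝ (L u) v) ((1 : ℝ) • v) := by
      simpa using hd.hasFDerivAt
    exact hd'.comp_hasDerivAt (1 : ℝ) h1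
  have h3 : HasDerivAt (fun c : ℝ => c ^ 2 * L u v) (2 * L u v) 1 := by
    simpa using (hasDerivAt_pow 2 (1 : ℝ)).mul_const (L u v)
  have h4 : (fun c : ℝ => L u (c • v)) =ᶠ[𝓝 1] fun c : ℝ => c ^ 2 * L u v := by
    filter_upwards [lt_mem_nhds (zero_lt_one)] with c hc using hL.homogeneous u v c hc
  exact h2.unique (h3.congr_of_eventuallyEq h4)

theorem momentum_eq {p : E × E} (hp : p ∈ T ×ˢ ({0}ᶜ : Set E)) :
    momentum L p = (2 : ℝ) • tensor L p.1 p.2 p.2 := by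
  rw [hL.tensor_apply_self hp.1 hp.2, smul_smul]
  norm_num [momentum]

theorem lagrangian_eq {p : E × E} (hp : p ∈ T ×ˢ ({0}ᶜ : Set E)) :
    L p.1 p.2 = tensor L p.1 p.2 p.2 p.2 := by
  rw [hL.tensor_apply_self hp.1 hp.2]
  have := hL.fderiv_apply_self hp.1 hp.2
  simp [this]

theorem contDiffAt_tensor {p : E × E} (hp : p ∈ T ×ˢ ({0}ᶜ : Set E)) :
    ContDiffAt ℝ 1 (fun p : E × E => tensor L p.1 p.2) p :=
  hL.c11.1.contDiffAt (hL.isOpen_prod.mem_nhds hp)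

theorem contDiffAt_momentum {p : E × E} (hp : p ∈ T ×ˢ ({0}ᶜ : Set E)) :
    ContDiffAt ℝ 1 (momentum L) p := by
  have h := ((hL.contDiffAt_tensor hp).clm_apply contDiffAt_snd).const_smul (2 : ℝ)
  refine h.congr_of_eventuallyEq ?_
  filter_upwards [hL.isOpen_prod.mem_nhds hp] with q hq using hL.momentum_eq hq

/-- No smoothness of `L` in the position is assumed: it is inherited from `tensor L` by Euler's
relation. -/
theorem contDiffAt_lagrangian {p : E × E} (hp : p ∈ T ×ˢ ({0}ᶜ : Set E)) :
    ContDiffAt ℝ 1 (fun q : E × E => L q.1 q.2) p := by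
  have h := ((hL.contDiffAt_tensor hp).clm_apply contDiffAt_snd).clm_apply contDiffAt_snd
  refine h.congr_of_eventuallyEq ?_
  filter_upwards [hL.isOpen_prod.mem_nhds hp] with q hq using hL.lagrangian_eq hq

theorem lipschitzNear_fderiv_tensor {p : E × E} (hp : p ∈ T ×ˢ ({0}ᶜ : Set E)) :
    LipschitzNear (fderiv ℝ (fun p : E × E => tensor L p.1 p.2)) p :=
  LocallyLipschitzOn.lipschitzNear hL.c11.2 hL.isOpen_prod hp

theorem fderiv_momentum {p : E × E} (hp : p ∈ T ×ˢ ({0}ᶜ : Set E)) :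
    fderiv ℝ (momentum L) p (p.2, 0) =
      (2 : ℝ) • fderiv ℝ (fun p : E × E => tensor L p.1 p.2) p (p.2, 0) p.2 := by
  have h1 := ((hL.contDiffAt_tensor hp).differentiableAt (by norm_num)).hasFDerivAt
  have h2 := (h1.clm_apply hasFDerivAt_snd).const_smul (2 : ℝ)
  have h3 : momentum L =ᶠ[𝓝 p] fun q => (2 : ℝ) • tensor L q.1 q.2 q.2 := by
    filter_upwards [hL.isOpen_prod.mem_nhds hp] with q hq using hL.momentum_eq hq
  rw [(h2.congr_of_eventuallyEq h3).fderiv]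
  simp

theorem fderiv_lagrangian {p : E × E} (hp : p ∈ T ×ˢ ({0}ᶜ : Set E)) (w : E) :
    fderiv ℝ (fun q : E × E => L q.1 q.2) p (w, 0) =
      fderiv ℝ (fun p : E × E => tensor L p.1 p.2) p (w, 0) p.2 p.2 := by
  have h1 := ((hL.contDiffAt_tensor hp).differentiableAt (by norm_num)).hasFDerivAt
  have h2 := (h1.clm_apply hasFDerivAt_snd).clm_apply hasFDerivAt_snd
  have h3 : (fun q : E × E => L q.1 q.2) =ᶠ[𝓝 p] fun q => tensor L q.1 q.2 q.2 q.2 := by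
    filter_upwards [hL.isOpen_prod.mem_nhds hp] with q hq using hL.lagrangian_eq hq
  rw [(h2.congr_of_eventuallyEq h3).fderiv]
  simp

theorem isInvertible_tensor [FiniteDimensional ℝ E] {p : E × E} (hp : p ∈ T ×ˢ ({0}ᶜ : Set E)) :
    (tensor L p.1 p.2).IsInvertible := by
  have hinj : Function.Injective (tensor L p.1 p.2 : E →ₗ[ℝ] E →L[ℝ] ℝ) := by
    rw [injective_iff_map_eq_zero]
    intro w hw
    by_contra hne
    have h1 := hL.posDef p.1 hp.1 p.2 hp.2 w hne
    have h2 : tensor L p.1 p.2 w = 0 := hw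
    simp [h2] at h1
  have hfin : Module.finrank ℝ E = Module.finrank ℝ (E →L[ℝ] ℝ) := by
    rw [← (LinearMap.toContinuousLinearMap (𝕜 := ℝ) (E := E) (F' := ℝ)).finrank_eq]
    exact (Subspace.dual_finrank_eq (K := ℝ) (V := E)).symm
  let e := (LinearEquiv.ofInjectiveOfFinrankEq
    (tensor L p.1 p.2 : E →ₗ[ℝ] E →L[ℝ] ℝ) hinj hfin).toContinuousLinearEquiv
  exact ⟨e, by ext; rfl⟩

/-- The Euler--Lagrange equation says that the derivative of the momentum along the curve is the
horizontal derivative of `L`. -/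
theorem eulerLagrange_iff_fderiv {u v : E} (hu : u ∈ T) (hv : v ≠ 0) (a : E) :
    EulerLagrange L u v a ↔ ∀ w, fderiv ℝ (momentum L) (u, v) (v, a) w =
      fderiv ℝ (fun q : E × E => L q.1 q.2) (u, v) (w, 0) := by
  have hp : (u, v) ∈ T ×ˢ ({0}ᶜ : Set E) := ⟨hu, hv⟩
  have hm := ((hL.contDiffAt_momentum hp).differentiableAt (by norm_num)).hasFDerivAt
  have hl := ((hL.contDiffAt_lagrangian hp).differentiableAt (by norm_num)).hasFDerivAt
  have hc1 : HasFDerivAt (fun u' : E => (u', v)) (ContinuousLinearMap.inl ℝ E E) u :=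
    hasFDerivAt_prodMk_left u v
  have hc2 : HasFDerivAt (fun v' : E => (u, v')) (ContinuousLinearMap.inr ℝ E E) v :=
    hasFDerivAt_prodMk_right u v
  have e1 : ∀ w, fderiv ℝ (fun u' => L u' v) u w =
      fderiv ℝ (fun q : E × E => L q.1 q.2) (u, v) (w, 0) := by
    intro w
    have := (hl.comp u hc1).fderiv
    exact congrArg (fun l => l w) this
  have e2 : ∀ w, tensor L u v a w = 1 / 2 * fderiv ℝ (momentum L) (u, v) (0, a) w := by
    intro w
    have h1 := (hm.comp v hc2).fderiv
    have h2 := congrArg (fun l => (1 / 2 : ℝ) • l a w) h1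
    exact h2
  have e3 : ∀ w, fderiv ℝ (fun u' => fderiv ℝ (fun z => L u' z) v w) u v =
      fderiv ℝ (momentum L) (u, v) (v, 0) w := by
    intro w
    have h1 := ((hm.comp u hc1).clm_apply (hasFDerivAt_const w u)).fderiv
    have h2 := congrArg (fun l => l v) h1
    refine h2.trans ?_
    simp
  have e4 : (v, a) = (v, (0 : E)) + ((0 : E), a) := by simp
  refine forall_congr' fun w => ?_
  rw [e1, e2, e3, e4, map_add]
  simp only [add_apply]
  constructor <;> intro h <;> linarith

/-- The Euler--Lagrange equation determines the acceleration. -/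
theorem eulerLagrange_iff [FiniteDimensional ℝ E] {u v : E} (hu : u ∈ T) (hv : v ≠ 0) (a : E) :
    EulerLagrange L u v a ↔ a = accel L (u, v) := by
  have hp : (u, v) ∈ T ×ˢ ({0}ᶜ : Set E) := ⟨hu, hv⟩
  obtain ⟨e, he⟩ := hL.isInvertible_tensor hp
  have h0 : ∀ w, tensor L u v a w = 1 / 2 * fderiv ℝ (momentum L) (u, v) (0, a) w := by
    intro w
    have hm := ((hL.contDiffAt_momentum hp).differentiableAt (by norm_num)).hasFDerivAt
    have h1 := (hm.comp v (hasFDerivAt_prodMk_right u v)).fderiv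
    exact congrArg (fun l => (1 / 2 : ℝ) • l a w) h1
  have h1 : a = accel L (u, v) ↔ tensor L u v a = (1 / 2 : ℝ) •
    ((fderiv ℝ (fun q : E × E => L q.1 q.2) (u, v)).comp (ContinuousLinearMap.inl ℝ E E)
      - fderiv ℝ (momentum L) (u, v) (v, 0)) := by
    unfold accel
    dsimp only at he ⊢
    rw [← he, ContinuousLinearMap.inverse_equiv]
    exact (e.eq_symm_apply).trans Iff.rfl
  rw [h1, hL.eulerLagrange_iff_fderiv hu hv, ContinuousLinearMap.ext_iff]
  refine forall_congr' fun w => ?_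
  have e4 : (v, a) = (v, (0 : E)) + ((0 : E), a) := by simp
  rw [h0, e4, map_add]
  simp only [add_apply, smul_apply,
    sub_apply, ContinuousLinearMap.comp_apply, smul_eq_mul,
    ContinuousLinearMap.inl_apply]
  constructor <;> intro h <;> linarith

/-- By Euler's relations the second derivatives in `accel L` are first derivatives of `tensor L`,
which are locally Lipschitz. -/
theorem lipschitzNear_accel [FiniteDimensional ℝ E] {p : E × E}
    (hp : p ∈ T ×ˢ ({0}ᶜ : Set E)) : LipschitzNear (accel L) p := by
  have : CompleteSpace E := FiniteDimensional.complete ℝ E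
  have h1 : LipschitzNear (fun q : E × E => (tensor L q.1 q.2).inverse) p := by
    refine ContDiffAt.lipschitzNear ?_
    exact ContDiffAt.comp p (hL.isInvertible_tensor hp).contDiffAt_map_inverse
      (hL.contDiffAt_tensor hp)
  have hg := hL.lipschitzNear_fderiv_tensor hp
  have hs : LipschitzNear (fun q : E × E => q.2) p := ContDiffAt.lipschitzNear contDiffAt_snd
  -- the force is a smooth function of the derivative of the tensor and of the velocity
  have h2 : ContDiff ℝ 1 (fun q : (E × E →L[ℝ] E →L[ℝ] E →L[ℝ] ℝ) × E =>
      (1 / 2 : ℝ) • ((ContinuousLinearMap.apply ℝ ℝ q.2).comp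
        ((ContinuousLinearMap.apply ℝ (E →L[ℝ] ℝ) q.2).comp
          (q.1.comp (ContinuousLinearMap.inl ℝ E E)))
        - (2 : ℝ) • q.1 (ContinuousLinearMap.inl ℝ E E q.2) q.2)) := by
    fun_prop
  have h3 : LipschitzNear _ p := LipschitzNear.comp
    (f := fun q => (fderiv ℝ (fun p : E × E => tensor L p.1 p.2) q, q.2))
    (ContDiffAt.lipschitzNear h2.contDiffAt) (hg.prodMk hs)
  refine (h1.clm_apply h3).congr ?_
  filter_upwards [hL.isOpen_prod.mem_nhds hp] with q hq
  unfold accel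
  congr 1
  ext w
  simp only [smul_apply, sub_apply,
    ContinuousLinearMap.comp_apply, ContinuousLinearMap.inl_apply]
  rw [hL.fderiv_momentum hq, hL.fderiv_lagrangian hq]
  rfl

theorem accel_smul [FiniteDimensional ℝ E] {u v : E} (hu : u ∈ T) (hv : v ≠ 0) {c : ℝ}
    (hc : 0 < c) : accel L (u, c • v) = c ^ 2 • accel L (u, v) := by
  have h := (hL.eulerLagrange_iff hu hv _).2 rfl
  refine ((hL.eulerLagrange_iff hu (smul_ne_zero hc.ne' hv) _).1 ?_).symm
  intro w
  have e1 : tensor L u (c • v) = tensor L u v := by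
    have h1 : fderiv ℝ (fun z => fderiv ℝ (L u) (c • z)) v = c • fderiv ℝ (fderiv ℝ (L u)) v := by
      have : (fun z => fderiv ℝ (L u) (c • z)) = fun z => c • fderiv ℝ (L u) z := by
        ext1 z; exact hL.fderiv_smul u z hc
      rw [this]
      exact fderiv_fun_const_smul_real _ _ _
    rw [fderiv_comp_smul] at h1
    have h2 := congrArg (fun l => c⁻¹ • l) h1
    simp only [smul_smul, inv_mul_cancel₀ hc.ne', one_smul] at h2
    exact congrArg (fun l => (1 / 2 : ℝ) • l) h2
  have e2 : fderiv ℝ (fun u' => fderiv ℝ (fun z => L u' z) (c • v) w) u =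
      c • fderiv ℝ (fun u' => fderiv ℝ (fun z => L u' z) v w) u := by
    have : (fun u' => fderiv ℝ (fun z => L u' z) (c • v) w) =
        fun u' => c • fderiv ℝ (fun z => L u' z) v w := by
      ext u'
      exact congrArg (fun l => l w) (hL.fderiv_smul u' v hc)
    rw [this]
    exact fderiv_fun_const_smul_real _ _ _
  have e3 : fderiv ℝ (fun u' => L u' (c • v)) u = c ^ 2 • fderiv ℝ (fun u' => L u' v) u := by
    have : (fun u' => L u' (c • v)) = fun u' => c ^ 2 • L u' v := by
      ext u'
      exact hL.homogeneous u' v c hc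
    rw [this]
    exact fderiv_fun_const_smul_real _ _ _
  rw [e1, e2, e3]
  simp only [map_smul, smul_apply, smul_eq_mul]
  linear_combination c ^ 2 * h w

end IsFinslerLagrangian

end Lagrangian

/-! ### Change of coordinates and time reversal -/

section ChangeOfCoordinates

variable {E : Type*} [NormedAddCommGroup E] [NormedSpace ℝ E]

/-- The tangent map of a change of coordinates. -/
def tangentCoord (τ : E → E) (q : E × E) : E × E := (τ q.1, fderiv ℝ τ q.1 q.2)

theorem hasFDerivAt_fderiv {τ : E → E} {u : E} (hτ : ContDiffAt ℝ 2 τ u) :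
    HasFDerivAt (fderiv ℝ τ) (fderiv ℝ (fderiv ℝ τ) u) u :=
  ((hτ.fderiv_right (m := 1) (by norm_num)).differentiableAt (by norm_num)).hasFDerivAt

theorem hasFDerivAt_tangentCoord {τ : E → E} {u : E} (v : E) (hτ : ContDiffAt ℝ 2 τ u) :
    ∃ Φ' : E × E →L[ℝ] E × E, HasFDerivAt (tangentCoord τ) Φ' (u, v) ∧
      ∀ a b, Φ' (a, b) = (fderiv ℝ τ u a, fderiv ℝ (fderiv ℝ τ) u a v + fderiv ℝ τ u b) := by
  have h1 : HasFDerivAt τ (fderiv ℝ τ u) (u, v).1 :=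
    (hτ.differentiableAt (by norm_num)).hasFDerivAt
  have h1' := h1.comp (u, v) hasFDerivAt_fst
  have h2' := HasFDerivAt.comp (u, v) (f := Prod.fst) (hasFDerivAt_fderiv hτ) hasFDerivAt_fst
  refine ⟨_, h1'.prodMk (h2'.clm_apply hasFDerivAt_snd), fun a b => ?_⟩
  simp [add_comm]

/-- Invariance of the Euler--Lagrange equation under a change of coordinates `τ`: the second
derivative of `τ` enters both terms of the equation, and these contributions cancel because it is
symmetric. -/
theorem eulerLagrange_change_iff {L L' : E → E → ℝ} {T T' : Set E} (hL : IsFinslerLagrangian L T)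
    (hL' : IsFinslerLagrangian L' T') {τ : E → E} {u v a : E} (hτ : ContDiffAt ℝ 2 τ u)
    (hu : u ∈ T') (hu' : τ u ∈ T)
    (hrel : ∀ᶠ z in 𝓝 u, ∀ w, L' z w = L (τ z) (fderiv ℝ τ z w))
    (hv : v ≠ 0) (hv' : fderiv ℝ τ u v ≠ 0) (hsurj : Function.Surjective (fderiv ℝ τ u)) :
    EulerLagrange L' u v a ↔ EulerLagrange L (τ u) (fderiv ℝ τ u v)
      (fderiv ℝ (fderiv ℝ τ) u v v + fderiv ℝ τ u a) := by
  rw [hL'.eulerLagrange_iff_fderiv hu hv, hL.eulerLagrange_iff_fderiv hu' hv']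
  have hp : (u, v) ∈ T' ×ˢ ({0}ᶜ : Set E) := ⟨hu, hv⟩
  have hp' : tangentCoord τ (u, v) ∈ T ×ˢ ({0}ᶜ : Set E) := ⟨hu', hv'⟩
  obtain ⟨Φ', hΦ, hΦ'⟩ := hasFDerivAt_tangentCoord v hτ
  have hsymm : IsSymmSndFDerivAt ℝ τ u := hτ.isSymmSndFDerivAt (by simp)
  have hm := ((hL'.contDiffAt_momentum hp).differentiableAt (by norm_num)).hasFDerivAt
  have hm' := ((hL.contDiffAt_momentum hp').differentiableAt (by norm_num)).hasFDerivAt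
  have hl' := ((hL.contDiffAt_lagrangian hp').differentiableAt (by norm_num)).hasFDerivAt
  have hev : ∀ᶠ q in 𝓝 (u, v), ∀ w, L' q.1 w = L (τ q.1) (fderiv ℝ τ q.1 w) :=
    (continuous_fst.tendsto (u, v)).eventually hrel
  have hmem : ∀ᶠ q in 𝓝 (u, v), tangentCoord τ q ∈ T ×ˢ ({0}ᶜ : Set E) :=
    hΦ.continuousAt.eventually (hL.isOpen_prod.mem_nhds hp')
  refine (forall_congr' fun w => ?_).trans (hsurj.forall (p := fun y =>
    fderiv ℝ (momentum L) (τ u, fderiv ℝ τ u v)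
      (fderiv ℝ τ u v, fderiv ℝ (fderiv ℝ τ) u v v + fderiv ℝ τ u a) y =
        fderiv ℝ (fun q : E × E => L q.1 q.2) (τ u, fderiv ℝ τ u v) (y, 0))).symm
  -- the momenta correspond to each other under the transpose of the tangent map
  have hmom : ∀ᶠ q in 𝓝 (u, v), momentum L' q w =
      momentum L (tangentCoord τ q) (fderiv ℝ τ q.1 w) := by
    filter_upwards [hev, hmem] with q hq hqm
    have hd : DifferentiableAt ℝ (L (τ q.1)) (fderiv ℝ τ q.1 q.2) :=
      ((hL.contDiffOn_fiber _ hqm.1).contDiffAt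
        (isOpen_compl_singleton.mem_nhds hqm.2)).differentiableAt (by norm_num)
    have h1 : L' q.1 = fun z => L (τ q.1) (fderiv ℝ τ q.1 z) := funext hq
    have h2 := (hd.hasFDerivAt.comp q.2 (fderiv ℝ τ q.1).hasFDerivAt).fderiv
    unfold momentum
    rw [h1]
    exact congrArg (fun l => l w) h2
  have hlag : ∀ᶠ q in 𝓝 (u, v), L' q.1 q.2 = L (tangentCoord τ q).1 (tangentCoord τ q).2 := by
    filter_upwards [hev] with q hq using hq q.2
  have e1 : fderiv ℝ (momentum L') (u, v) (v, a) w =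
      fderiv ℝ (momentum L) (tangentCoord τ (u, v)) (Φ' (v, a)) (fderiv ℝ τ u w) +
        momentum L (tangentCoord τ (u, v)) (fderiv ℝ (fderiv ℝ τ) u v w) := by
    have h1 := hm.clm_apply (hasFDerivAt_const w (u, v))
    have h2 := (hm'.comp (u, v) hΦ).clm_apply
      ((HasFDerivAt.comp (u, v) (f := Prod.fst) (hasFDerivAt_fderiv hτ)
        hasFDerivAt_fst).clm_apply (hasFDerivAt_const w (u, v)))
    have h3 := h1.unique (h2.congr_of_eventuallyEq hmom)
    have h4 := congrArg (fun l => l (v, a)) h3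
    simp only [add_apply, ContinuousLinearMap.comp_apply, ContinuousLinearMap.flip_apply,
      zero_apply, map_zero, zero_add, Function.comp_apply] at h4
    rw [h4, add_comm]
    rfl
  have e2 : fderiv ℝ (fun q : E × E => L' q.1 q.2) (u, v) (w, 0) =
      fderiv ℝ (fun q : E × E => L q.1 q.2) (tangentCoord τ (u, v)) (Φ' (w, 0)) := by
    have h2 := ((hl'.comp (u, v) hΦ).congr_of_eventuallyEq hlag).fderiv
    exact congrArg (fun l => l (w, 0)) h2
  have e3 : ∀ z, fderiv ℝ (fun q : E × E => L q.1 q.2) (tangentCoord τ (u, v)) (0, z) =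
      momentum L (tangentCoord τ (u, v)) z := by
    intro z
    have h1 := (HasFDerivAt.comp (fderiv ℝ τ u v) (f := fun y : E => (τ u, y)) hl'
      (hasFDerivAt_prodMk_right (τ u) (fderiv ℝ τ u v))).fderiv
    exact (congrArg (fun l => l z) h1).symm
  have e4 : Φ' (w, 0) = (fderiv ℝ τ u w, 0) + (0, fderiv ℝ (fderiv ℝ τ) u w v) := by
    rw [hΦ']; simp
  rw [e1, e2, e4, map_add, e3, hsymm w v, hΦ', add_left_inj]
  exact Iff.rfl

theorem fderiv_comp_neg {V W : Type*} [NormedAddCommGroup V] [NormedSpace ℝ V]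
    [NormedAddCommGroup W] [NormedSpace ℝ W] (f : V → W) (x : V) :
    fderiv ℝ (fun y => f (-y)) x = -fderiv ℝ f (-x) := by
  simpa using fderiv_comp_smul (f := f) (x := x) (-1 : ℝ)

theorem tensor_reverse (L : E → E → ℝ) (u v : E) :
    tensor (fun u v => L u (-v)) u v = tensor L u (-v) := by
  have h1 : (fun w => fderiv ℝ (fun z => L u (-z)) w) =
      fun w => -fderiv ℝ (fun z => L u z) (-w) := by
    ext1 w
    exact fderiv_comp_neg (L u) w
  have h2 : fderiv ℝ (fun w => -fderiv ℝ (fun z => L u z) (-w)) v =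
      -fderiv ℝ (fun w => fderiv ℝ (fun z => L u z) (-w)) v := fderiv_fun_neg
  have h3 : fderiv ℝ (fun w => fderiv ℝ (fun z => L u z) (-w)) v =
      -fderiv ℝ (fun w => fderiv ℝ (fun z => L u z) w) (-v) :=
    fderiv_comp_neg (fun w => fderiv ℝ (fun z => L u z) w) v
  unfold tensor
  rw [h1, h2, h3, neg_neg]

/-- The reversal `(u, v) ↦ (u, -v)` of the tangent bundle. -/
def fiberNeg (E : Type*) [NormedAddCommGroup E] [NormedSpace ℝ E] : E × E →L[ℝ] E × E :=
  (ContinuousLinearMap.fst ℝ E E).prod (-ContinuousLinearMap.snd ℝ E E)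

/-- Time reversal of a Lagrangian of Finsler type. -/
theorem IsFinslerLagrangian.reverse {L : E → E → ℝ} {T : Set E} (hL : IsFinslerLagrangian L T) :
    IsFinslerLagrangian (fun u v => L u (-v)) T where
  isOpen := hL.isOpen
  homogeneous u v c hc := by rw [← smul_neg, hL.homogeneous u _ c hc]
  contDiffOn_fiber u hu :=
    (hL.contDiffOn_fiber u hu).comp contDiff_neg.contDiffOn fun v hv => by simpa using hv
  posDef u hu v hv w hw := by
    rw [tensor_reverse]
    exact hL.posDef u hu _ (neg_ne_zero.2 hv) w hw
  c11 := by
    have h1 : (fun p : E × E => tensor (fun u v => L u (-v)) p.1 p.2) =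
        fun p => (fun p : E × E => tensor L p.1 p.2) (fiberNeg E p) := by
      ext1 p; exact tensor_reverse L p.1 p.2
    have hm : ∀ p ∈ T ×ˢ ({0}ᶜ : Set E), fiberNeg E p ∈ T ×ˢ ({0}ᶜ : Set E) :=
      fun p hp => ⟨hp.1, neg_ne_zero.2 hp.2⟩
    rw [h1]
    refine ⟨hL.c11.1.comp (fiberNeg E).contDiff.contDiffOn hm,
      LipschitzNear.locallyLipschitzOn fun p hp => ?_⟩
    have h2 := hL.lipschitzNear_fderiv_tensor (hm p hp)
    have h3 : LipschitzNear
        (fun q => fderiv ℝ (fun p : E × E => tensor L p.1 p.2) (fiberNeg E q)) p :=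
      h2.comp (ContDiffAt.lipschitzNear (fiberNeg E).contDiff.contDiffAt)
    have h4 : ContDiff ℝ 1 (fun l : E × E →L[ℝ] E →L[ℝ] E →L[ℝ] ℝ => l.comp (fiberNeg E)) := by
      fun_prop
    refine (LipschitzNear.comp (ContDiffAt.lipschitzNear h4.contDiffAt) h3).congr ?_
    filter_upwards [hL.isOpen_prod.mem_nhds hp] with q hq
    have h5 := ((hL.contDiffAt_tensor (hm q hq)).differentiableAt (by norm_num)).hasFDerivAt
    exact (h5.comp q (fiberNeg E).hasFDerivAt).fderiv.symm

theorem eulerLagrange_reverse {L : E → E → ℝ} {u v a : E} :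
    EulerLagrange (fun u v => L u (-v)) u v a ↔ EulerLagrange L u (-v) a := by
  refine forall_congr' fun w => ?_
  have h1 : (fun u' => fderiv ℝ (fun z => L u' (-z)) v w) =
      fun u' => -(fderiv ℝ (fun z => L u' z) (-v) w) := by
    ext1 u'
    exact congrArg (fun l => l w) (fderiv_comp_neg (L u') v)
  have h2 : fderiv ℝ (fun u' => -(fderiv ℝ (fun z => L u' z) (-v) w)) u =
      -fderiv ℝ (fun u' => fderiv ℝ (fun z => L u' z) (-v) w) u := fderiv_fun_neg
  rw [tensor_reverse, h1, h2]
  simp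

end ChangeOfCoordinates

/-! ### Geodesics in charts -/

theorem two_le_infty : (2 : WithTop ℕ∞) ≤ ∞ := WithTop.coe_le_coe.2 le_top

section Charts

variable {E : Type*} [NormedAddCommGroup E] [NormedSpace ℝ E]
  {M : Type*} [TopologicalSpace M] [ChartedSpace E M]

/-- In each chart of the atlas, the square of `F` is a Lagrangian of Finsler type. -/
def IsFinslerInCharts (F : (x : M) → TangentSpace 𝓘(ℝ, E) x → ℝ) : Prop :=
  ∀ e ∈ atlas E M, IsFinslerLagrangian (sqInChart F e) e.target

theorem sqInChart_reversed (F : (x : M) → TangentSpace 𝓘(ℝ, E) x → ℝ)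
    (e : OpenPartialHomeomorph M E) :
    sqInChart (reversed F) e = fun u v => sqInChart F e u (-v) := by
  ext u v
  exact congrArg (fun y => F (e.symm u) y ^ 2)
    (map_neg (mfderiv 𝓘(ℝ, E) 𝓘(ℝ, E) e.symm u) v).symm

theorem IsFinslerInCharts.reversed {F : (x : M) → TangentSpace 𝓘(ℝ, E) x → ℝ}
    (hF : IsFinslerInCharts F) : IsFinslerInCharts (reversed F) := by
  intro e he
  rw [sqInChart_reversed]
  exact (hF e he).reverse

variable [IsManifold 𝓘(ℝ, E) ∞ M]

theorem IsFinslerMetric.isFinslerInCharts {F : (x : M) → TangentSpace 𝓘(ℝ, E) x → ℝ}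
    (hF : IsFinslerMetric F) : IsFinslerInCharts F := by
  intro e he
  refine ⟨e.open_target, fun u v c hc => ?_, hF.contDiffOn_fiber e he, hF.posDef e he,
    hF.c11 e he⟩
  have h1 : sqInChart F e u (c • v) =
      F (e.symm u) (c • mfderiv 𝓘(ℝ, E) 𝓘(ℝ, E) e.symm u v) ^ 2 :=
    congrArg (fun y => F (e.symm u) y ^ 2)
      (map_smul (mfderiv 𝓘(ℝ, E) 𝓘(ℝ, E) e.symm u) c v)
  rw [h1, hF.homogeneous _ _ c hc, mul_pow]
  rfl

/-- The transition maps of the atlas are smooth. -/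
theorem contDiffAt_transition {e e' : OpenPartialHomeomorph M E} (he : e ∈ atlas E M)
    (he' : e' ∈ atlas E M) {u : E} (hu : u ∈ e'.target) (hu' : e'.symm u ∈ e.source) :
    ContDiffAt ℝ ∞ (e ∘ e'.symm) u := by
  have h := 𝓘(ℝ, E).contDiffWithinAt_extendCoordChange' (n := ∞)
    (IsManifold.subset_maximalAtlas he') (IsManifold.subset_maximalAtlas he)
    (e'.map_target hu) hu'
  have h2 : e'.extend 𝓘(ℝ, E) (e'.symm u) = u := e'.right_inv hu
  rw [h2, modelWithCornersSelf_coe, range_id, contDiffWithinAt_univ] at h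
  exact h

omit [NormedSpace ℝ E] [ChartedSpace E M] [IsManifold 𝓘(ℝ, E) ∞ M] in
theorem eventually_mem_transition_source {e e' : OpenPartialHomeomorph M E} {u : E}
    (hu : u ∈ e'.target) (hu' : e'.symm u ∈ e.source) :
    ∀ᶠ z in 𝓝 u, z ∈ e'.target ∧ e'.symm z ∈ e.source :=
  (e'.open_target.eventually_mem hu).and
    ((e'.continuousAt_symm hu).eventually (e.open_source.mem_nhds hu'))

theorem fderiv_transition_comp {e e' : OpenPartialHomeomorph M E} (he : e ∈ atlas E M)
    (he' : e' ∈ atlas E M) {x : M} (hx : x ∈ e.source) (hx' : x ∈ e'.source) (v : E) :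
    fderiv ℝ (e ∘ e'.symm) (e' x) (fderiv ℝ (e' ∘ e.symm) (e x) v) = v := by
  have h1 : DifferentiableAt ℝ (e' ∘ e.symm) (e x) :=
    (contDiffAt_transition he' he (e.map_source hx) (by rwa [e.left_inv hx])).differentiableAt
      (by norm_num)
  have hpt : (e' ∘ e.symm) (e x) = e' x := by simp [e.left_inv hx]
  have h2 : DifferentiableAt ℝ (e ∘ e'.symm) ((e' ∘ e.symm) (e x)) := by
    rw [hpt]
    exact (contDiffAt_transition he he' (e'.map_source hx')
      (by rwa [e'.left_inv hx'])).differentiableAt (by norm_num)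
  have h3 := (h2.hasFDerivAt.comp (e x) h1.hasFDerivAt)
  have h4 : (e ∘ e'.symm) ∘ (e' ∘ e.symm) =ᶠ[𝓝 (e x)] id := by
    filter_upwards [eventually_mem_transition_source (e := e') (e.map_source hx)
      (by rwa [e.left_inv hx])] with z hz
    simp [e'.left_inv hz.2, e.right_inv hz.1]
  have h5 := h3.unique ((hasFDerivAt_id (e x)).congr_of_eventuallyEq h4)
  rw [hpt] at h5
  exact congrArg (fun l => l v) h5

/-- The differential of a chart inverse, with the tangent space identified with the model space by
the preferred chart. -/
theorem mfderiv_symm_eq_fderiv {e : OpenPartialHomeomorph M E} (he : e ∈ atlas E M) {u : E}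
    (hu : u ∈ e.target) (v : E) :
    (mfderiv 𝓘(ℝ, E) 𝓘(ℝ, E) e.symm u v : E) =
      fderiv ℝ (chartAt E (e.symm u) ∘ e.symm) u v := by
  have h : MDifferentiableAt 𝓘(ℝ, E) 𝓘(ℝ, E) e.symm u :=
    mdifferentiableAt_atlas_symm he hu
  have h2 : fderivWithin ℝ (writtenInExtChartAt 𝓘(ℝ, E) 𝓘(ℝ, E) u e.symm) (range 𝓘(ℝ, E))
      (extChartAt 𝓘(ℝ, E) u u) = fderiv ℝ (chartAt E (e.symm u) ∘ e.symm) u := by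
    simp only [modelWithCornersSelf_coe, range_id, fderivWithin_univ]
    rfl
  exact congrArg (fun l : E →L[ℝ] E => l v) (h.mfderiv.trans h2)

/-- The squares of `F` in two charts correspond to each other under the tangent map of the
transition map. -/
theorem sqInChart_change (F : (x : M) → TangentSpace 𝓘(ℝ, E) x → ℝ)
    {e e' : OpenPartialHomeomorph M E} (he : e ∈ atlas E M)
    (he' : e' ∈ atlas E M) {u : E} (hu : u ∈ e'.target) (hu' : e'.symm u ∈ e.source) (v : E) :
    sqInChart F e' u v = sqInChart F e ((e ∘ e'.symm) u) (fderiv ℝ (e ∘ e'.symm) u v) := by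
  have key : ∀ (x x' : M) (y y' : E), x = x' → y = y' →
      F x (show TangentSpace 𝓘(ℝ, E) x from y) = F x' (show TangentSpace 𝓘(ℝ, E) x' from y') := by
    rintro x _ y _ rfl rfl; rfl
  have hx : e.symm ((e ∘ e'.symm) u) = e'.symm u := e.left_inv hu'
  have ht : (e ∘ e'.symm) u ∈ e.target := e.map_source hu'
  refine congrArg (· ^ 2) (key _ _ _ _ hx.symm ?_)
  rw [mfderiv_symm_eq_fderiv he' hu, mfderiv_symm_eq_fderiv he ht, hx]
  set κ := chartAt E (e'.symm u)
  have hκ : κ ∈ atlas E M := chart_mem_atlas E _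
  have hs : e'.symm u ∈ κ.source := mem_chart_source E _
  have h1 : DifferentiableAt ℝ (e ∘ e'.symm) u :=
    (contDiffAt_transition he he' hu hu').differentiableAt (by norm_num)
  have h2 : DifferentiableAt ℝ (κ ∘ e.symm) ((e ∘ e'.symm) u) :=
    (contDiffAt_transition hκ he ht (by rwa [hx])).differentiableAt (by norm_num)
  have h3 : κ ∘ e'.symm =ᶠ[𝓝 u] (κ ∘ e.symm) ∘ (e ∘ e'.symm) := by
    filter_upwards [eventually_mem_transition_source (e := e) hu hu'] with z hz
    simp [e.left_inv hz.2]
  rw [h3.fderiv_eq, fderiv_comp u h2 h1]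
  rfl

/-- The geodesic equation does not depend on the chart. -/
theorem GeodesicEquation.change {F : (x : M) → TangentSpace 𝓘(ℝ, E) x → ℝ}
    (hF : IsFinslerInCharts F) {e e' : OpenPartialHomeomorph M E} (he : e ∈ atlas E M)
    (he' : e' ∈ atlas E M) {u v a : E} (hu : u ∈ e'.target) (hu' : e'.symm u ∈ e.source)
    (hv : v ≠ 0) (h : GeodesicEquation F e' u v a) :
    fderiv ℝ (e ∘ e'.symm) u v ≠ 0 ∧
    GeodesicEquation F e ((e ∘ e'.symm) u) (fderiv ℝ (e ∘ e'.symm) u v)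
      (fderiv ℝ (fderiv ℝ (e ∘ e'.symm)) u v v + fderiv ℝ (e ∘ e'.symm) u a) := by
  have hinv := fderiv_transition_comp he' he (e'.map_target hu) hu'
  have hinv' := fderiv_transition_comp he he' hu' (e'.map_target hu)
  rw [e'.right_inv hu] at hinv hinv'
  have hv' : fderiv ℝ (e ∘ e'.symm) u v ≠ 0 := by
    intro h0
    apply hv
    rw [← hinv v, h0, map_zero]
  refine ⟨hv', ?_⟩
  refine (eulerLagrange_change_iff (hF e he) (hF e' he')
    ((contDiffAt_transition he he' hu hu').of_le two_le_infty) hu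
    (e.map_source hu') ?_ hv hv' fun w => ⟨_, hinv' w⟩).1 h
  filter_upwards [eventually_mem_transition_source hu hu'] with z hz w
  exact sqInChart_change F he he' hz.1 hz.2 w

/-- Near `t₀`, in the chart `e`, the curve `γ` is regular, twice differentiable within `J`, and a
solution of the geodesic equation. -/
def IsGeodesicNear (F : (x : M) → TangentSpace 𝓘(ℝ, E) x → ℝ) (e : OpenPartialHomeomorph M E)
    (γ : ℝ → M) (J : Set ℝ) (t₀ : ℝ) : Prop :=
  ∃ v a : ℝ → E, ∀ᶠ t in 𝓝[J] t₀,
    γ t ∈ e.source ∧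
    HasDerivWithinAt (fun s => e (γ s)) (v t) J t ∧
    HasDerivWithinAt v (a t) J t ∧
    v t ≠ 0 ∧
    GeodesicEquation F e (e (γ t)) (v t) (a t)

omit [IsManifold 𝓘(ℝ, E) ∞ M] in
theorem IsGeodesicNear.continuousWithinAt {F : (x : M) → TangentSpace 𝓘(ℝ, E) x → ℝ}
    {e : OpenPartialHomeomorph M E} {γ : ℝ → M} {J : Set ℝ} {t₀ : ℝ} (ht₀ : t₀ ∈ J)
    (h : IsGeodesicNear F e γ J t₀) : ContinuousWithinAt γ J t₀ := by
  obtain ⟨v, a, h⟩ := h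
  have h0 := h.self_of_nhdsWithin ht₀
  have h1 : ContinuousWithinAt (fun s => e.symm (e (γ s))) J t₀ :=
    ContinuousAt.comp_continuousWithinAt (g := e.symm) (f := fun s => e (γ s))
      (e.continuousAt_symm (e.map_source h0.1)) h0.2.1.continuousWithinAt
  refine h1.congr_of_eventuallyEq ?_ (e.left_inv h0.1).symm
  filter_upwards [h] with t ht using (e.left_inv ht.1).symm

theorem IsGeodesicNear.change {F : (x : M) → TangentSpace 𝓘(ℝ, E) x → ℝ}
    (hF : IsFinslerInCharts F) {e e' : OpenPartialHomeomorph M E} (he : e ∈ atlas E M)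
    (he' : e' ∈ atlas E M) {γ : ℝ → M} {J : Set ℝ} {t₀ : ℝ} (ht₀ : t₀ ∈ J)
    (hs : γ t₀ ∈ e.source) (h : IsGeodesicNear F e' γ J t₀) : IsGeodesicNear F e γ J t₀ := by
  have hc := h.continuousWithinAt ht₀
  obtain ⟨v, a, h⟩ := h
  have hsrc : ∀ᶠ t in 𝓝[J] t₀, γ t ∈ e.source := hc.eventually (e.open_source.mem_nhds hs)
  have h' := h.and hsrc
  refine ⟨fun t => fderiv ℝ (e ∘ e'.symm) (e' (γ t)) (v t),
    fun t => fderiv ℝ (fderiv ℝ (e ∘ e'.symm)) (e' (γ t)) (v t) (v t) +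
      fderiv ℝ (e ∘ e'.symm) (e' (γ t)) (a t), ?_⟩
  filter_upwards [h', eventually_eventually_nhdsWithin.2 h', self_mem_nhdsWithin]
    with t ht ht' htJ
  obtain ⟨⟨h1, h2, h3, h4, h5⟩, h6⟩ := ht
  have hu : e' (γ t) ∈ e'.target := e'.map_source h1
  have hu' : e'.symm (e' (γ t)) ∈ e.source := by rwa [e'.left_inv h1]
  have hτ : ContDiffAt ℝ 2 (e ∘ e'.symm) (e' (γ t)) :=
    (contDiffAt_transition he he' hu hu').of_le two_le_infty
  have hpt : (e ∘ e'.symm) (e' (γ t)) = e (γ t) := by simp [e'.left_inv h1]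
  obtain ⟨h7, h8⟩ := h5.change hF he he' hu hu' h4
  rw [hpt] at h8
  refine ⟨h6, ?_, ?_, h7, h8⟩
  · have h9 := (hτ.differentiableAt (by norm_num)).hasFDerivAt.comp_hasDerivWithinAt t h2
    refine h9.congr_of_eventuallyEq ?_ hpt.symm
    filter_upwards [ht'] with s hs
    simp [e'.left_inv hs.1.1]
  · have h9 : HasDerivWithinAt (fun s => fderiv ℝ (e ∘ e'.symm) (e' (γ s)))
        (fderiv ℝ (fderiv ℝ (e ∘ e'.symm)) (e' (γ t)) (v t)) J t :=
      (hasFDerivAt_fderiv hτ).comp_hasDerivWithinAt t h2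
    exact h9.clm_apply h3

end Charts

/-! ### A second-order differential inequality, and other facts of analysis -/

section Analysis

/-- A differential inequality of second order on a short interval: a function that starts with
value and slope zero, and whose acceleration is at most `A |f| + B |f'|`, cannot become positive.
If `|f'|` has maximum `N` then `f'` can increase by less than `N` altogether; hence `f'` neither
reaches the value `N` nor returns from the value `-N` to a nonnegative one. -/
theorem nonpos_of_second_deriv_le {f p q : ℝ → ℝ} {a b A B : ℝ}
    (hf : ∀ t ∈ Icc a b, HasDerivWithinAt f (p t) (Icc a b) t)
    (hp : ∀ t ∈ Icc a b, HasDerivWithinAt p (q t) (Icc a b) t)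
    (hf0 : f a = 0) (hp0 : p a = 0) (hA : 0 ≤ A) (hB : 0 ≤ B)
    (hq : ∀ t ∈ Icc a b, q t ≤ A * |f t| + B * |p t|)
    (hsmall : (A * (b - a) + B) * (b - a) < 1) {t : ℝ} (ht : t ∈ Icc a b) : f t ≤ 0 := by
  have hpc : ContinuousOn p (Icc a b) := fun t ht => (hp t ht).continuousWithinAt
  have key : ∀ t₁ ∈ Icc a b, p t₁ ≤ 0 := by
    intro t₁ ht₁
    by_contra! hpos
    have hsub : Icc a t₁ ⊆ Icc a b := Icc_subset_Icc_right ht₁.2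
    obtain ⟨t₂, ht₂, hmax⟩ := isCompact_Icc.exists_isMaxOn (nonempty_Icc.2 ht₁.1)
      ((hpc.mono hsub).abs)
    set N := |p t₂| with hN
    have hmax' : ∀ s ∈ Icc a t₁, |p s| ≤ N := hmax
    have hNpos : 0 < N := (abs_pos.2 hpos.ne').trans_le (hmax' t₁ ⟨ht₁.1, le_rfl⟩)
    have hab : 0 ≤ b - a := by linarith [ht₁.1, ht₁.2]
    have hfb : ∀ s ∈ Icc a t₁, |f s| ≤ N * (b - a) := by
      intro s hs
      have h1 := (convex_Icc a t₁).norm_image_sub_le_of_norm_hasDerivWithin_le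
        (fun x hx => (hf x (hsub hx)).mono hsub) hmax' ⟨le_rfl, ht₁.1⟩ hs
      have h2 : (0 : ℝ) ≤ s - a := sub_nonneg.2 hs.1
      rw [hf0, sub_zero, Real.norm_eq_abs, Real.norm_eq_abs, abs_of_nonneg h2] at h1
      exact h1.trans (mul_le_mul_of_nonneg_left (by linarith [hs.2, ht₁.2]) hNpos.le)
    set K := (A * (b - a) + B) * N with hK
    have hK0 : 0 ≤ K := by positivity
    have hmono : MonotoneOn (fun s => K * s - p s) (Icc a t₁) := by
      refine monotoneOn_of_hasDerivWithinAt_nonneg (f' := fun s => K - q s) (convex_Icc a t₁)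
        ?_ ?_ ?_
      · exact (continuousOn_const.mul continuousOn_id).sub (hpc.mono hsub)
      · intro s hs
        have h1 := ((hasDerivWithinAt_id s (Icc a b)).const_mul K).sub
          (hp s (hsub (interior_subset hs)))
        rw [mul_one] at h1
        exact h1.mono (interior_subset.trans hsub)
      · intro s hs
        have hs := interior_subset hs
        have h1 := hq s (hsub hs)
        have h2 : A * |f s| ≤ A * (N * (b - a)) := by gcongr; exact hfb s hs
        have h3 : B * |p s| ≤ B * N := by gcongr; exact hmax' s hs
        simp only [hK]
        linarith
    have hinc : ∀ s ∈ Icc a t₁, ∀ s' ∈ Icc a t₁, s ≤ s' → p s' - p s < N := by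
      intro s hs s' hs' hss
      have h1 := hmono hs hs' hss
      simp only at h1
      have h2 : K * (s' - s) ≤ K * (b - a) := by
        gcongr
        · linarith [hs'.2, ht₁.2]
        · exact hs.1
      have h3 : K * (b - a) < N := by
        have : K * (b - a) = ((A * (b - a) + B) * (b - a)) * N := by ring
        rw [this]
        nlinarith
      linarith
    rcases le_total 0 (p t₂) with h | h
    · have h1 := hinc a ⟨le_rfl, ht₁.1⟩ t₂ ht₂ ht₂.1
      rw [hp0, hN, abs_of_nonneg h] at h1
      linarith
    · have h1 := hinc t₂ ht₂ t₁ ⟨ht₁.1, le_rfl⟩ ht₂.2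
      rw [hN, abs_of_nonpos h] at h1
      linarith
  have hanti : MonotoneOn (fun s => -f s) (Icc a b) := by
    refine monotoneOn_of_hasDerivWithinAt_nonneg (f' := fun s => -p s) (convex_Icc a b) ?_ ?_ ?_
    · exact fun s hs => (hf s hs).continuousWithinAt.neg
    · intro s hs
      exact ((hf s (interior_subset hs)).mono interior_subset).neg
    · intro s hs
      have := key s (interior_subset hs)
      linarith
  have := hanti ⟨le_rfl, ht.1.trans ht.2⟩ ht ht.1
  simp only [hf0] at this
  linarith

/-- A function with value and slope zero and positive second derivative at `0` is positive near
`0`. -/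
theorem eventually_pos_of_second_deriv_pos {f p : ℝ → ℝ} {h : ℝ}
    (hf : ∀ᶠ t in 𝓝 0, HasDerivAt f (p t) t) (hp : HasDerivAt p h 0) (hf0 : f 0 = 0)
    (hp0 : p 0 = 0) (hh : 0 < h) : ∀ᶠ t in 𝓝[≠] 0, 0 < f t := by
  have h1 : ∀ᶠ t in 𝓝 0, HasDerivAt (fun s => f s - h / 4 * s ^ 2) (p t - h / 2 * t) t := by
    filter_upwards [hf] with t ht
    have := ht.sub ((hasDerivAt_pow 2 t).const_mul (h / 4))
    convert! this using 1
    simp; ring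
  have h2 : deriv (fun s => f s - h / 4 * s ^ 2) =ᶠ[𝓝 0] fun t => p t - h / 2 * t := by
    filter_upwards [h1] with t ht using ht.deriv
  have h3 : HasDerivAt (fun t => p t - h / 2 * t) (h - h / 2) 0 := by
    have := hp.sub ((hasDerivAt_id (0 : ℝ)).const_mul (h / 2))
    rw [mul_one] at this
    exact this
  have h4 : IsLocalMin (fun s => f s - h / 4 * s ^ 2) 0 := by
    apply isLocalMin_of_deriv_deriv_pos
    · rw [h2.deriv_eq, h3.deriv]; linarith
    · rw [h2.eq_of_nhds, hp0]; simp
    · exact h1.self_of_nhds.continuousAt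
  rw [eventually_nhdsWithin_iff]
  filter_upwards [h4] with t ht ht0
  simp only [hf0] at ht
  have : 0 < t ^ 2 := (sq_pos_iff).2 ht0
  nlinarith

/-- Local existence of integral curves of a vector field that is Lipschitz near the initial
point. -/
theorem LipschitzNear.exists_integralCurve {V : Type*} [NormedAddCommGroup V] [NormedSpace ℝ V]
    [CompleteSpace V] {X : V → V} {x₀ : V} (hX : LipschitzNear X x₀) :
    ∃ ε > 0, ∃ α : ℝ → V, α 0 = x₀ ∧ ∀ t ∈ Ioo (-ε) ε, HasDerivAt α (X (α t)) t := by
  have hc := hX.continuousAt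
  obtain ⟨K, s, hs, hl⟩ := hX
  have hb : ∀ᶠ x in 𝓝 x₀, ‖X x‖ ≤ ‖X x₀‖ + 1 :=
    (hc.norm.eventually_lt continuousAt_const (by simp)).mono fun x hx => hx.le
  obtain ⟨a, ha, has⟩ := Metric.nhds_basis_closedBall.mem_iff.1 (inter_mem hs hb)
  set L : ℝ := ‖X x₀‖ + 1 with hL
  have hL0 : 0 < L := by positivity
  have hε : 0 < a / L := by positivity
  have hPL : IsPicardLindelof (fun _ => X) (tmin := -(a / L)) (tmax := a / L)
      ⟨0, by constructor <;> linarith⟩ x₀ ⟨a, ha.le⟩ 0 ⟨L, hL0.le⟩ K := by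
    refine IsPicardLindelof.of_time_independent (fun x hx => (has hx).2)
      (hl.mono fun x hx => (has hx).1) ?_
    simp only [sub_zero, zero_sub, neg_neg, max_self]
    change L * (a / L) ≤ a - 0
    rw [sub_zero, mul_div_cancel₀ _ hL0.ne']
  obtain ⟨α, hα0, hα⟩ := hPL.exists_eq_forall_mem_Icc_hasDerivWithinAt₀
  exact ⟨a / L, hε, α, hα0, fun t ht =>
    (hα t (Ioo_subset_Icc_self ht)).hasDerivAt (Icc_mem_nhds ht.1 ht.2)⟩

/-- Metric regularity: near a zero where the derivative of `Ψ` is onto, the distance to the zero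
set of `Ψ` is bounded by a multiple of the norm of `Ψ`. -/
theorem exists_zero_near {V W : Type*} [NormedAddCommGroup V] [NormedSpace ℝ V] [CompleteSpace V]
    [NormedAddCommGroup W] [NormedSpace ℝ W] [CompleteSpace W] {Ψ : V → W} {Ψ' : V →L[ℝ] W}
    {p₀ : V} (hΨ : HasStrictFDerivAt Ψ Ψ' p₀) (hsurj : Ψ'.range = ⊤) (h0 : Ψ p₀ = 0) :
    ∃ C > 0, ∀ᶠ p in 𝓝 p₀, ∃ p', ‖p' - p‖ ≤ C * ‖Ψ p‖ ∧ Ψ p' = 0 := by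
  set R := Ψ'.nonlinearRightInverseOfSurjective hsurj
  have hR : 0 < R.nnnorm := Ψ'.nonlinearRightInverseOfSurjective_nnnorm_pos hsurj
  obtain ⟨s, hs, hap⟩ := hΨ.approximates_deriv_on_nhds (c := R.nnnorm⁻¹ / 2)
    (Or.inr (half_pos (inv_pos.2 hR)))
  obtain ⟨r, hr, hrs⟩ := Metric.mem_nhds_iff.1 hs
  set k : ℝ := (R.nnnorm : ℝ)⁻¹ - ((R.nnnorm⁻¹ / 2 : NNReal) : ℝ) with hk
  have hk0 : 0 < k := by
    have : (0 : ℝ) < (R.nnnorm : ℝ)⁻¹ := by positivity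
    simp only [hk, NNReal.coe_div, NNReal.coe_inv, NNReal.coe_ofNat]
    linarith
  refine ⟨k⁻¹, by positivity, ?_⟩
  have hlim : Tendsto (fun p => k⁻¹ * ‖Ψ p‖) (𝓝 p₀) (𝓝 0) := by
    have : ContinuousAt (fun p => k⁻¹ * ‖Ψ p‖) p₀ :=
      continuousAt_const.mul hΨ.continuousAt.norm
    simpa [ContinuousAt, h0] using this
  filter_upwards [Metric.ball_mem_nhds p₀ (half_pos hr), hlim.eventually_lt_const (half_pos hr)]
    with p hp hp'
  have hε0 : 0 ≤ k⁻¹ * ‖Ψ p‖ := by positivity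
  have hball : Metric.closedBall p (k⁻¹ * ‖Ψ p‖) ⊆ s := by
    refine Subset.trans (fun z hz => ?_) hrs
    rw [Metric.mem_closedBall] at hz
    rw [Metric.mem_ball] at hp ⊢
    linarith [dist_triangle z p p₀]
  have h1 := hap.surjOn_closedBall_of_nonlinearRightInverse R hε0 hball
  rw [← hk, ← mul_assoc, mul_inv_cancel₀ hk0.ne', one_mul] at h1
  obtain ⟨p', hp', hz⟩ := h1 (show (0 : W) ∈ _ by simp [dist_eq_norm])
  exact ⟨p', by simpa [dist_eq_norm] using hp', hz⟩

/-- A local estimate that holds near each point of a compact set `K` of velocities holds with a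
uniform constant. -/
theorem exists_uniform_const {X Y : Type*} [TopologicalSpace X] [TopologicalSpace Y] {K : Set Y}
    (hK : IsCompact K) (x₀ : X) {P : ℝ → X × Y → Prop}
    (hmono : ∀ C C' p, C ≤ C' → P C p → P C' p)
    (h : ∀ y ∈ K, ∃ C, ∀ᶠ p in 𝓝 (x₀, y), P C p) :
    ∃ C > 0, ∀ᶠ x in 𝓝 x₀, ∀ y ∈ K, P C (x, y) := by
  refine hK.induction_on (p := fun s => ∃ C > 0, ∀ᶠ x in 𝓝 x₀, ∀ y ∈ s, P C (x, y))
    ⟨1, one_pos, by simp⟩ ?_ ?_ ?_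
  · rintro s t hst ⟨C, hC, h⟩
    exact ⟨C, hC, h.mono fun x hx y hy => hx y (hst hy)⟩
  · rintro s t ⟨C, hC, h⟩ ⟨C', hC', h'⟩
    refine ⟨max C C', lt_max_of_lt_left hC, ?_⟩
    filter_upwards [h, h'] with x hx hx' y hy
    rcases hy with hy | hy
    · exact hmono _ _ _ (le_max_left _ _) (hx y hy)
    · exact hmono _ _ _ (le_max_right _ _) (hx' y hy)
  · intro y hy
    obtain ⟨C, hC⟩ := h y hy
    rw [nhds_prod_eq, eventually_prod_iff] at hC
    obtain ⟨pa, ha, pb, hb, hab⟩ := hC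
    refine ⟨{y | pb y}, mem_nhdsWithin_of_mem_nhds hb, max C 1, by positivity, ?_⟩
    filter_upwards [ha] with x hx y hy
    exact hmono _ _ _ (le_max_left _ _) (hab hx hy)

/-- Near a regular zero `u₀` of `f`, the set `{f > 0}` is connected: any two of its points are
joined by three segments, the first and last in a direction `n` in which `f` increases. Hence a set
`S` that accumulates at `u₀`, on which `f > 0` and whose frontier consists of zeros of `f`, contains
`{f > 0}` near `u₀`. -/
theorem eventually_mem_of_pos {V : Type*} [NormedAddCommGroup V] [NormedSpace ℝ V]
    {f : V → ℝ} {f' : V →L[ℝ] ℝ} {u₀ : V} {S : Set V} (hf : HasStrictFDerivAt f f' u₀)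
    (hf' : f' ≠ 0) (hu₀ : u₀ ∈ closure S)
    (hS : ∀ᶠ z in 𝓝 u₀, z ∈ S → 0 < f z) (hfr : ∀ᶠ z in 𝓝 u₀, z ∈ frontier S → f z = 0) :
    ∀ᶠ z in 𝓝 u₀, 0 < f z → z ∈ S := by
  obtain ⟨m, hm⟩ : ∃ m, f' m ≠ 0 := by
    by_contra! h
    exact hf' (ContinuousLinearMap.ext h)
  obtain ⟨n, hn⟩ : ∃ n, f' n = 1 := ⟨(f' m)⁻¹ • m, by simp [hm]⟩
  have hn0 : 0 < ‖n‖ := norm_pos_iff.2 fun h => by simp [h] at hn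
  set c : NNReal := ⟨(2 * ‖n‖)⁻¹, by positivity⟩ with hc
  have hcn : (c : ℝ) * ‖n‖ = 1 / 2 := by
    change (2 * ‖n‖)⁻¹ * ‖n‖ = 1 / 2
    field_simp
  obtain ⟨s, hs, hap⟩ := hf.approximates_deriv_on_nhds (c := c)
    (Or.inr (by change 0 < (2 * ‖n‖)⁻¹; positivity))
  obtain ⟨r, hr, hrs⟩ := Metric.mem_nhds_iff.1 (inter_mem hs (hS.and hfr))
  have hinc : ∀ z ∈ Metric.ball u₀ r, ∀ l : ℝ, 0 ≤ l → z + l • n ∈ Metric.ball u₀ r →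
      f z + l / 2 ≤ f (z + l • n) := by
    intro z hz l hl hz'
    have h1 := hap _ (hrs hz').1 _ (hrs hz).1
    rw [add_sub_cancel_left, map_smul, hn, smul_eq_mul, mul_one, norm_smul, Real.norm_eq_abs,
      Real.norm_eq_abs, abs_of_nonneg hl] at h1
    have h2 := (abs_le.1 h1).1
    have h3 : (c : ℝ) * (l * ‖n‖) = l / 2 := by rw [mul_left_comm, hcn]; ring
    linarith
  -- `f > 0` on a segment, so that the segment does not meet the frontier of `S`
  have hseg : ∀ y z, y ∈ S → (∀ x ∈ segment ℝ y z, x ∈ Metric.ball u₀ r ∧ 0 < f x) → z ∈ S := by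
    intro y z hy hyz
    by_contra hz
    have hdisj : ∀ x ∈ segment ℝ y z, x ∉ frontier S := fun x hx hx' =>
      (hyz x hx).2.ne' ((hrs (hyz x hx).1).2.2 hx')
    have hsub : segment ℝ y z ⊆ interior S ∪ (closure S)ᶜ := by
      intro x hx
      by_contra h
      simp only [mem_union, mem_compl_iff, not_or, not_not] at h
      exact hdisj x hx ⟨h.2, h.1⟩
    have hy' : y ∈ interior S := by
      by_contra h
      exact hdisj y (left_mem_segment ℝ y z) ⟨subset_closure hy, h⟩
    have h1 := (convex_segment y z).isPreconnected.subset_left_of_subset_union isOpen_interior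
      isClosed_closure.isOpen_compl
      (disjoint_compl_right.mono_left (interior_subset.trans subset_closure)) hsub
      ⟨y, left_mem_segment ℝ y z, hy'⟩
    exact hz (interior_subset (h1 (right_mem_segment ℝ y z)))
  set L : ℝ := c + ‖f'‖ with hL
  have hL0 : 0 ≤ L := by positivity
  have hlip : ∀ y ∈ Metric.ball u₀ r, ∀ z ∈ Metric.ball u₀ r, f y - L * ‖z - y‖ ≤ f z := by
    intro y hy z hz
    have h1 := hap _ (hrs hz).1 _ (hrs hy).1
    have h2 := f'.le_opNorm (z - y)
    rw [Real.norm_eq_abs] at h1 h2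
    have h3 := (abs_le.1 h1).1
    have h4 := (abs_le.1 h2).1
    rw [hL, add_mul]
    linarith
  -- the length `l` of the outer segments, and the radius `ρ` of the smaller neighbourhood
  set l : ℝ := r / (4 * ‖n‖) with hl
  have hl0 : 0 < l := by positivity
  have hln : l * ‖n‖ = r / 4 := by rw [hl]; field_simp
  set ρ : ℝ := min (r / 2) (l / (8 * (L + 1))) with hρ
  have hρ0 : 0 < ρ := by positivity
  have hρr : ρ ≤ r / 2 := min_le_left _ _
  have hLρ : L * (2 * ρ) ≤ l / 4 := by
    have h1 : ρ ≤ l / (8 * (L + 1)) := min_le_right _ _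
    rw [le_div_iff₀ (by positivity)] at h1
    nlinarith
  have hshift : ∀ z ∈ Metric.ball u₀ ρ, ∀ k : ℝ, 0 ≤ k → k ≤ l →
      z + k • n ∈ Metric.ball u₀ r := by
    intro z hz k hk hkl
    rw [Metric.mem_ball, dist_eq_norm] at hz ⊢
    have h1 : ‖k • n‖ ≤ r / 4 := by
      rw [norm_smul, Real.norm_eq_abs, abs_of_nonneg hk, ← hln]
      gcongr
    have h2 : z + k • n - u₀ = (z - u₀) + k • n := by abel
    rw [h2]
    linarith [norm_add_le (z - u₀) (k • n)]
  have hsmall : Metric.ball u₀ ρ ⊆ Metric.ball u₀ r := Metric.ball_subset_ball (by linarith)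
  have hside : ∀ z ∈ Metric.ball u₀ ρ, 0 < f z → ∀ x ∈ segment ℝ z (z + l • n),
      x ∈ Metric.ball u₀ r ∧ 0 < f x := by
    intro z hz hfz x hx
    rw [segment_eq_image'] at hx
    obtain ⟨θ, hθ, rfl⟩ := hx
    simp only [add_sub_cancel_left, smul_smul]
    have h1 : 0 ≤ θ * l := mul_nonneg hθ.1 hl0.le
    have h2 := hshift z hz (θ * l) h1 (by nlinarith [hθ.2])
    have h3 := hinc z (hsmall hz) (θ * l) h1 h2
    exact ⟨h2, by linarith⟩
  obtain ⟨q, hqρ, hqS⟩ := mem_closure_iff_nhds.1 hu₀ _ (Metric.ball_mem_nhds u₀ hρ0)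
  have hqpos : 0 < f q := (hrs (hsmall hqρ)).2.1 hqS
  filter_upwards [Metric.ball_mem_nhds u₀ hρ0] with p hp hfp
  have h1 : q + l • n ∈ S := hseg _ _ hqS (hside q hqρ hqpos)
  have h2 : p + l • n ∈ S := by
    refine hseg _ _ h1 fun x hx => ?_
    rw [segment_eq_image'] at hx
    obtain ⟨θ, hθ, rfl⟩ := hx
    have hz : q + θ • (p - q) ∈ Metric.ball u₀ ρ :=
      (convex_ball u₀ ρ).segment_subset hqρ hp (segment_eq_image' ℝ q p ▸ ⟨θ, hθ, rfl⟩)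
    have hx' : q + l • n + θ • (p + l • n - (q + l • n)) = (q + θ • (p - q)) + l • n := by
      rw [add_sub_add_right_eq_sub]; abel
    simp only [hx']
    have h3 := hshift _ hz l hl0.le le_rfl
    have h4 := hinc _ (hsmall hz) l hl0.le h3
    have h5 := hlip q (hsmall hqρ) _ (hsmall hz)
    have h6 : ‖q + θ • (p - q) - q‖ ≤ 2 * ρ := by
      rw [Metric.mem_ball, dist_eq_norm] at hz hqρ
      have : q + θ • (p - q) - q = (q + θ • (p - q) - u₀) - (q - u₀) := by abel
      rw [this]
      linarith [norm_sub_le (q + θ • (p - q) - u₀) (q - u₀)]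
    have h7 : L * ‖q + θ • (p - q) - q‖ ≤ L * (2 * ρ) := by gcongr
    exact ⟨h3, by linarith⟩
  exact hseg _ _ h2 fun x hx => hside p hp hfp x (by rwa [segment_symm] at hx)

/-- Continuous induction on an interval: the induction step may use the whole past. -/
theorem Icc_subset_of_forall_Icc_subset {Q : Set ℝ} {a b : ℝ} (hQ : IsClosed (Q ∩ Icc a b))
    (ha : a ∈ Q) (h : ∀ t ∈ Ico a b, Icc a t ⊆ Q → Q ∈ 𝓝[>] t) : Icc a b ⊆ Q := by
  set S := {t | Icc a t ⊆ Q} with hS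
  have hSQ : S ∩ Icc a b ⊆ Q ∩ Icc a b := fun t ht => ⟨ht.1 ⟨ht.2.1, le_rfl⟩, ht.2⟩
  have hcl : IsClosed (S ∩ Icc a b) := by
    refine isClosed_of_closure_subset fun t ht => ?_
    have htQ : t ∈ Q ∩ Icc a b := closure_minimal hSQ hQ ht
    refine ⟨fun s hs => ?_, htQ.2⟩
    rcases hs.2.eq_or_lt with rfl | hst
    · exact htQ.1
    · obtain ⟨t', ht', ht'S⟩ := mem_closure_iff_nhds.1 ht _ (Ioi_mem_nhds hst)
      exact ht'S.1 ⟨hs.1, le_of_lt ht'⟩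
  have h1 := hcl.Icc_subset_of_forall_mem_nhdsWithin (show a ∈ S by simpa [hS] using ha)
    fun t ht => ?_
  · exact fun t ht => h1 ht ⟨ht.1, le_rfl⟩
  · have h2 := h t ht.2 ht.1
    obtain ⟨t', ht', hsub⟩ := mem_nhdsGT_iff_exists_Ioo_subset.1 h2
    filter_upwards [Ioo_mem_nhdsGT ht'] with s hs r hr
    rcases le_or_gt r t with hrt | hrt
    · exact ht.1 ⟨hr.1, hrt⟩
    · exact hsub ⟨hrt, hr.2.trans_lt hs.2⟩

theorem notMem_of_mem_frontier {X : Type*} [TopologicalSpace X] {D : Set X} (hD : IsOpen D) {x : X}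
    (hx : x ∈ frontier D) : x ∉ D := fun h => by
  have h1 : x ∈ D ∩ frontier D := ⟨h, hx⟩
  rwa [hD.inter_frontier_eq] at h1

end Analysis

/-! ### The Hessian along geodesics -/

section Hessian

variable {E : Type*} [NormedAddCommGroup E] [NormedSpace ℝ E]

/-- The Finslerian Hessian of `φ` in coordinates: the second derivative of `φ` along the solution
of the Euler--Lagrange equation of `L` with position `p.1` and velocity `p.2`. -/
def hessianForm (L : E → E → ℝ) (φ : E → ℝ) (p : E × E) : ℝ :=
  fderiv ℝ (fderiv ℝ φ) p.1 p.2 p.2 + fderiv ℝ φ p.1 (accel L p)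

theorem hasDerivWithinAt_comp_curve {φ : E → ℝ} {c : ℝ → E} {v : E} {J : Set ℝ} {t : ℝ}
    (hφ : ContDiffAt ℝ 2 φ (c t)) (hc : HasDerivWithinAt c v J t) :
    HasDerivWithinAt (fun s => φ (c s)) (fderiv ℝ φ (c t) v) J t :=
  (hφ.differentiableAt (by norm_num)).hasFDerivAt.comp_hasDerivWithinAt t hc

theorem hasDerivWithinAt_fderiv_curve {L : E → E → ℝ} {φ : E → ℝ} {c w : ℝ → E} {J : Set ℝ}
    {t : ℝ} (hφ : ContDiffAt ℝ 2 φ (c t)) (hc : HasDerivWithinAt c (w t) J t)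
    (hw : HasDerivWithinAt w (accel L (c t, w t)) J t) :
    HasDerivWithinAt (fun s => fderiv ℝ φ (c s) (w s)) (hessianForm L φ (c t, w t)) J t := by
  have h : HasFDerivAt (fderiv ℝ φ) (fderiv ℝ (fderiv ℝ φ) (c t)) (c t) :=
    ((hφ.fderiv_right (m := 1) (by norm_num)).differentiableAt (by norm_num)).hasFDerivAt
  have h1 : HasDerivWithinAt (fun s => fderiv ℝ φ (c s))
      (fderiv ℝ (fderiv ℝ φ) (c t) (w t)) J t := h.comp_hasDerivWithinAt t hc
  exact h1.clm_apply hw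

variable {L : E → E → ℝ} {T : Set E} {φ : E → ℝ}

variable [FiniteDimensional ℝ E]

theorem hessianForm_smul (hL : IsFinslerLagrangian L T) {u v : E} (hu : u ∈ T) (hv : v ≠ 0)
    {c : ℝ} (hc : 0 < c) : hessianForm L φ (u, c • v) = c ^ 2 * hessianForm L φ (u, v) := by
  unfold hessianForm
  rw [hL.accel_smul hu hv hc]
  simp only [map_smul, smul_apply, smul_eq_mul]
  ring

theorem lipschitzNear_hessianForm (hL : IsFinslerLagrangian L T) {p : E × E}
    (hp : p ∈ T ×ˢ ({0}ᶜ : Set E)) (hφ : ContDiffAt ℝ 2 φ p.1)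
    (hφ' : LipschitzNear (fderiv ℝ (fderiv ℝ φ)) p.1) : LipschitzNear (hessianForm L φ) p := by
  have h1 : LipschitzNear (fun q : E × E => q.1) p := ContDiffAt.lipschitzNear contDiffAt_fst
  have h2 : LipschitzNear (fun q : E × E => q.2) p := ContDiffAt.lipschitzNear contDiffAt_snd
  have h3 : LipschitzNear (fun q : E × E => fderiv ℝ (fderiv ℝ φ) q.1 q.2 q.2) p :=
    (LipschitzNear.clm_apply (LipschitzNear.comp (f := fun q : E × E => q.1) hφ' h1)
      h2).clm_apply h2
  have h4 : LipschitzNear (fderiv ℝ φ) p.1 :=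
    ContDiffAt.lipschitzNear (hφ.fderiv_right (m := 1) (by norm_num))
  have h5 : LipschitzNear (fun q : E × E => fderiv ℝ φ q.1 (accel L q)) p :=
    (LipschitzNear.comp (f := fun q : E × E => q.1) h4 h1).clm_apply (hL.lipschitzNear_accel hp)
  have h6 : ContDiff ℝ 1 (fun x : ℝ × ℝ => x.1 + x.2) := by fun_prop
  exact LipschitzNear.comp (f := fun q : E × E =>
    (fderiv ℝ (fderiv ℝ φ) q.1 q.2 q.2, fderiv ℝ φ q.1 (accel L q)))
    (ContDiffAt.lipschitzNear h6.contDiffAt) (h3.prodMk h5)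

/-- The local form of the key estimate. A pair `(u, v)` near a vector tangent to `{φ = 0}` is at
distance `O(|φ(u)| + |dφ(v)|)` from a tangent vector, at which the Hessian is nonpositive, and the
Hessian is Lipschitz; near a vector that is not tangent the estimate is trivial. -/
theorem exists_hessianForm_le_near (hL : IsFinslerLagrangian L T) {u₀ v₀ : E} (hu₀ : u₀ ∈ T)
    (hv₀ : v₀ ≠ 0) (hφ : ContDiffAt ℝ 2 φ u₀) (hφ' : LipschitzNear (fderiv ℝ (fderiv ℝ φ)) u₀)
    (h0 : φ u₀ = 0) (hreg : fderiv ℝ φ u₀ ≠ 0)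
    (hconv : ∀ᶠ u in 𝓝 u₀, φ u = 0 → ∀ v, v ≠ 0 → fderiv ℝ φ u v = 0 →
      hessianForm L φ (u, v) ≤ 0) :
    ∃ C, ∀ᶠ p in 𝓝 (u₀, v₀), hessianForm L φ p ≤ C * (|φ p.1| + |fderiv ℝ φ p.1 p.2|) := by
  have : CompleteSpace E := FiniteDimensional.complete ℝ E
  have hp₀ : (u₀, v₀) ∈ T ×ˢ ({0}ᶜ : Set E) := ⟨hu₀, hv₀⟩
  have hlip := lipschitzNear_hessianForm hL hp₀ hφ hφ'
  have hD : ContDiffAt ℝ 1 (fun p : E × E => fderiv ℝ φ p.1 p.2) (u₀, v₀) :=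
    (ContDiffAt.comp (u₀, v₀) (f := fun p : E × E => p.1)
      (hφ.fderiv_right (m := 1) (by norm_num)) contDiffAt_fst).clm_apply contDiffAt_snd
  by_cases htan : fderiv ℝ φ u₀ v₀ = 0
  · have hΨ : ContDiffAt ℝ 1 (fun p : E × E => (φ p.1, fderiv ℝ φ p.1 p.2)) (u₀, v₀) :=
      (ContDiffAt.comp (u₀, v₀) (f := fun p : E × E => p.1)
        (hφ.of_le (by norm_num)) contDiffAt_fst).prodMk hD
    have hstrict := hΨ.hasStrictFDerivAt (by norm_num)
    have hd1 : HasFDerivAt φ (fderiv ℝ φ u₀) u₀ :=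
      (hφ.differentiableAt (by norm_num)).hasFDerivAt
    have hd2 : HasFDerivAt (fderiv ℝ φ) (fderiv ℝ (fderiv ℝ φ) u₀) u₀ :=
      ((hφ.fderiv_right (m := 1) (by norm_num)).differentiableAt (by norm_num)).hasFDerivAt
    have hd : HasFDerivAt (fun p : E × E => (φ p.1, fderiv ℝ φ p.1 p.2)) _ (u₀, v₀) :=
      (HasFDerivAt.comp (u₀, v₀) (f := fun p : E × E => p.1) hd1 hasFDerivAt_fst).prodMk
        ((HasFDerivAt.comp (u₀, v₀) (f := fun p : E × E => p.1) hd2 hasFDerivAt_fst).clm_apply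
          hasFDerivAt_snd)
    rw [hd.fderiv] at hstrict
    obtain ⟨m, hm⟩ : ∃ m, fderiv ℝ φ u₀ m ≠ 0 := by
      by_contra! h
      exact hreg (ContinuousLinearMap.ext h)
    obtain ⟨n, hn⟩ : ∃ n, fderiv ℝ φ u₀ n = 1 := ⟨(fderiv ℝ φ u₀ m)⁻¹ • m, by simp [hm]⟩
    obtain ⟨C, hC, hev⟩ := exists_zero_near hstrict (by
      rw [LinearMap.range_eq_top]
      rintro ⟨s, t⟩
      refine ⟨(s • n, (t - fderiv ℝ (fderiv ℝ φ) u₀ (s • n) v₀) • n), ?_⟩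
      simp [hn]) (by simp [h0, htan])
    obtain ⟨K, S, hS, hK⟩ := hlip
    -- the projection `p'` of `p` tends to `(u₀, v₀)` with `p`
    have hgood : ∀ᶠ p in 𝓝 (u₀, v₀), p ∈ S ∧ p.2 ≠ 0 ∧
        (φ p.1 = 0 → ∀ v, v ≠ 0 → fderiv ℝ φ p.1 v = 0 → hessianForm L φ (p.1, v) ≤ 0) :=
      (show ∀ᶠ p in 𝓝 (u₀, v₀), p ∈ S from hS).and ((continuousAt_snd.eventually_ne hv₀).and
        ((continuous_fst.tendsto (u₀, v₀)).eventually hconv))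
    obtain ⟨r, hr, hrs⟩ := Metric.mem_nhds_iff.1 hgood
    have hlim : Tendsto (fun p : E × E => C * ‖(φ p.1, fderiv ℝ φ p.1 p.2)‖) (𝓝 (u₀, v₀))
        (𝓝 0) := by
      have h1 : ContinuousAt (fun p : E × E => C * ‖(φ p.1, fderiv ℝ φ p.1 p.2)‖) (u₀, v₀) :=
        continuousAt_const.mul hΨ.continuousAt.norm
      simpa [ContinuousAt, h0, htan] using h1
    refine ⟨K * C, ?_⟩
    filter_upwards [hev, Metric.ball_mem_nhds (u₀, v₀) (half_pos hr),
      hlim.eventually_lt_const (half_pos hr)] with p hp hpr hpl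
    obtain ⟨p', hp', hz⟩ := hp
    have hp'r : p' ∈ Metric.ball (u₀, v₀) r := by
      rw [Metric.mem_ball] at hpr ⊢
      have := dist_triangle p' p (u₀, v₀)
      rw [dist_eq_norm p' p] at this
      linarith
    have hpr' : p ∈ Metric.ball (u₀, v₀) r := Metric.ball_subset_ball (by linarith) hpr
    obtain ⟨hS', hne, hcv⟩ := hrs hp'r
    have h1 : hessianForm L φ p' ≤ 0 := by
      rw [Prod.mk_eq_zero] at hz
      exact hcv hz.1 p'.2 hne hz.2
    have h2 := hK.norm_sub_le (hrs hpr').1 hS'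
    rw [norm_sub_rev p p'] at h2
    have h3 : hessianForm L φ p - hessianForm L φ p' ≤ K * ‖p' - p‖ :=
      (le_abs_self _).trans h2
    have h4 : ‖(φ p.1, fderiv ℝ φ p.1 p.2)‖ ≤ |φ p.1| + |fderiv ℝ φ p.1 p.2| := by
      rw [Prod.norm_def]
      exact max_le (by simp) (by simp)
    calc hessianForm L φ p ≤ K * ‖p' - p‖ := by linarith
      _ ≤ K * (C * (|φ p.1| + |fderiv ℝ φ p.1 p.2|)) := by
        gcongr
        exact hp'.trans (by gcongr)
      _ = _ := by ring
  · set δ := |fderiv ℝ φ u₀ v₀| / 2 with hδ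
    have hδ0 : 0 < δ := half_pos (abs_pos.2 htan)
    have h1 : ∀ᶠ p in 𝓝 (u₀, v₀), δ < |fderiv ℝ φ p.1 p.2| :=
      hD.continuousAt.abs.eventually_const_lt (half_lt_self (abs_pos.2 htan))
    set B := |hessianForm L φ (u₀, v₀)| + 1 with hB
    have h2 : ∀ᶠ p in 𝓝 (u₀, v₀), hessianForm L φ p < B :=
      hlip.continuousAt.eventually_lt_const ((le_abs_self _).trans_lt (lt_add_one _))
    refine ⟨B / δ, ?_⟩
    filter_upwards [h1, h2] with p hp hp'
    have hB0 : 0 < B := by positivity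
    calc hessianForm L φ p ≤ B / δ * δ := by rw [div_mul_cancel₀ _ hδ0.ne']; exact hp'.le
      _ ≤ B / δ * (|φ p.1| + |fderiv ℝ φ p.1 p.2|) := by
        gcongr
        linarith [abs_nonneg (φ p.1)]

/-- If the Hessian of `φ` is nonpositive on the vectors tangent to `{φ = 0}`, it is bounded on all
vectors by the amounts by which they fail to be tangent. -/
theorem exists_hessianForm_le (hL : IsFinslerLagrangian L T) {u₀ : E} (hu₀ : u₀ ∈ T)
    (hφ : ContDiffAt ℝ 2 φ u₀) (hφ' : LipschitzNear (fderiv ℝ (fderiv ℝ φ)) u₀)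
    (h0 : φ u₀ = 0) (hreg : fderiv ℝ φ u₀ ≠ 0)
    (hconv : ∀ᶠ u in 𝓝 u₀, φ u = 0 → ∀ v, v ≠ 0 → fderiv ℝ φ u v = 0 →
      hessianForm L φ (u, v) ≤ 0) :
    ∃ C > 0, ∀ᶠ u in 𝓝 u₀, ∀ v, v ≠ 0 → hessianForm L φ (u, v) ≤
      C * (|φ u| * ‖v‖ ^ 2 + |fderiv ℝ φ u v| * ‖v‖) := by
  obtain ⟨C, hC, hev⟩ := exists_uniform_const (isCompact_sphere (0 : E) 1) u₀
    (P := fun C p => hessianForm L φ p ≤ C * (|φ p.1| + |fderiv ℝ φ p.1 p.2|))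
    (fun C C' p h hp => hp.trans (by gcongr)) (fun v hv => exists_hessianForm_le_near hL hu₀
      (Metric.ne_of_mem_sphere hv one_ne_zero) hφ hφ' h0 hreg hconv)
  refine ⟨C, hC, ?_⟩
  filter_upwards [hev, hL.isOpen.mem_nhds hu₀] with u hu huT v hv
  have hv0 : 0 < ‖v‖ := norm_pos_iff.2 hv
  have h1 : ‖v‖ • (‖v‖⁻¹ • v) = v := by rw [smul_smul, mul_inv_cancel₀ hv0.ne', one_smul]
  have h2 := hu (‖v‖⁻¹ • v) (by simp [norm_smul, hv0.ne'])
  have h3 : hessianForm L φ (u, v) = ‖v‖ ^ 2 * hessianForm L φ (u, ‖v‖⁻¹ • v) := by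
    conv_lhs => rw [← h1]
    exact hessianForm_smul hL huT (smul_ne_zero (by positivity) hv) hv0
  have h4 : |fderiv ℝ φ u (‖v‖⁻¹ • v)| = ‖v‖⁻¹ * |fderiv ℝ φ u v| := by
    rw [map_smul, smul_eq_mul, abs_mul, abs_of_pos (inv_pos.2 hv0)]
  rw [h3]
  calc ‖v‖ ^ 2 * hessianForm L φ (u, ‖v‖⁻¹ • v)
      ≤ ‖v‖ ^ 2 * (C * (|φ u| + |fderiv ℝ φ u (‖v‖⁻¹ • v)|)) := by gcongr
    _ = _ := by rw [h4]; field_simp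

theorem exists_norm_accel_le (hL : IsFinslerLagrangian L T) {u₀ : E} (hu₀ : u₀ ∈ T) :
    ∃ C > 0, ∀ᶠ u in 𝓝 u₀, ∀ v, v ≠ 0 → ‖accel L (u, v)‖ ≤ C * ‖v‖ ^ 2 := by
  obtain ⟨C, hC, hev⟩ := exists_uniform_const (isCompact_sphere (0 : E) 1) u₀
    (P := fun C p => ‖accel L p‖ ≤ C)
    (fun C C' p h hp => hp.trans h) (fun v hv => ⟨‖accel L (u₀, v)‖ + 1,
      ((hL.lipschitzNear_accel (p := (u₀, v))
        ⟨hu₀, Metric.ne_of_mem_sphere hv one_ne_zero⟩).continuousAt.norm.eventually_le_const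
          (lt_add_one _))⟩)
  refine ⟨C, hC, ?_⟩
  filter_upwards [hev, hL.isOpen.mem_nhds hu₀] with u hu huT v hv
  have hv0 : 0 < ‖v‖ := norm_pos_iff.2 hv
  have h1 : ‖v‖ • (‖v‖⁻¹ • v) = v := by rw [smul_smul, mul_inv_cancel₀ hv0.ne', one_smul]
  have h2 := hu (‖v‖⁻¹ • v) (by simp [norm_smul, hv0.ne'])
  conv_lhs => rw [← h1]
  rw [hL.accel_smul huT (smul_ne_zero (by positivity) hv) hv0, norm_smul, norm_pow, norm_norm,
    mul_comm]
  gcongr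

end Hessian

/-! ### Velocities and local solutions -/

section Velocity

variable {E : Type*} [NormedAddCommGroup E] [NormedSpace ℝ E]
  {M : Type*} [TopologicalSpace M] [ChartedSpace E M]

theorem tangentBundle_mk_inj {x x' : M} {y y' : E}
    (h : (⟨x, y⟩ : TangentBundle 𝓘(ℝ, E) M) = ⟨x', y'⟩) : x = x' ∧ y = y' := by
  cases h
  exact ⟨rfl, rfl⟩

theorem velocity_eq_of_hasDerivWithinAt {γ : ℝ → M} {J : Set ℝ} {t : ℝ} {y : E}
    (hJ : UniqueDiffWithinAt ℝ J t) (hc : ContinuousWithinAt γ J t)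
    (h : HasDerivWithinAt (fun s => chartAt E (γ t) (γ s)) y J t) :
    velocity E γ J t = ⟨γ t, y⟩ := by
  have h1 : HasMFDerivWithinAt 𝓘(ℝ, ℝ) 𝓘(ℝ, E) γ J t
      (ContinuousLinearMap.toSpanSingleton ℝ y : ℝ →L[ℝ] E) := by
    refine ⟨hc, ?_⟩
    have h2 := h.hasFDerivWithinAt
    simpa [writtenInExtChartAt, Function.comp_def] using! h2
  have h3 := h1.mfderivWithin hJ.uniqueMDiffWithinAt
  have h4 : (mfderivWithin 𝓘(ℝ, ℝ) 𝓘(ℝ, E) γ J t (1 : ℝ) : E) = y := by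
    have h5 := congrArg (fun l : ℝ →L[ℝ] E => l 1) h3
    exact h5.trans (by simp)
  unfold velocity
  exact congrArg (fun z : E => (⟨γ t, z⟩ : TangentBundle 𝓘(ℝ, E) M)) h4

theorem velocity_of_const {γ : ℝ → M} {J : Set ℝ} {t : ℝ} {p : M} (ht : t ∈ J)
    (hJ : UniqueDiffWithinAt ℝ J t) (h : ∀ s ∈ J, γ s = p) :
    velocity E γ J t = ⟨p, (0 : E)⟩ := by
  have hp : γ t = p := h t ht
  rw [← hp]
  refine velocity_eq_of_hasDerivWithinAt hJ ?_ ?_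
  · exact (continuousWithinAt_const (b := γ t)).congr (fun s hs => by rw [h s hs, hp]) rfl
  · exact (hasDerivWithinAt_const t J (chartAt E (γ t) (γ t))).congr
      (fun s hs => by simp only [h s hs, hp]) rfl

variable [IsManifold 𝓘(ℝ, E) ∞ M]

/-- The velocity of `γ`, computed in any chart of the atlas. -/
theorem velocity_eq_of_chart {γ : ℝ → M} {J : Set ℝ} {t : ℝ} {v : E}
    {e : OpenPartialHomeomorph M E} (he : e ∈ atlas E M) (hs : γ t ∈ e.source)
    (hJ : UniqueDiffWithinAt ℝ J t) (hc : ContinuousWithinAt γ J t)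
    (h : HasDerivWithinAt (fun s => e (γ s)) v J t) :
    velocity E γ J t = ⟨γ t, fderiv ℝ (chartAt E (γ t) ∘ e.symm) (e (γ t)) v⟩ := by
  refine velocity_eq_of_hasDerivWithinAt hJ hc ?_
  have h1 : DifferentiableAt ℝ (chartAt E (γ t) ∘ e.symm) (e (γ t)) :=
    (contDiffAt_transition (chart_mem_atlas E _) he (e.map_source hs)
      (by rw [e.left_inv hs]; exact mem_chart_source E _)).differentiableAt (by norm_num)
  refine (h1.hasFDerivAt.comp_hasDerivWithinAt t h).congr_of_eventuallyEq ?_ ?_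
  · filter_upwards [hc.eventually (e.open_source.mem_nhds hs)] with s hs'
    simp [e.left_inv hs']
  · simp [e.left_inv hs]

/-- A regular geodesic, seen in a chart `e`: its second derivative is given by `accel`. -/
theorem IsGeodesicNear.hasDerivWithinAt [FiniteDimensional ℝ E]
    {F : (x : M) → TangentSpace 𝓘(ℝ, E) x → ℝ}
    (hF : IsFinslerInCharts F) {e e' : OpenPartialHomeomorph M E} (he : e ∈ atlas E M)
    (he' : e' ∈ atlas E M) {γ : ℝ → M} {J : Set ℝ} {t₀ : ℝ} (hJ : UniqueDiffOn ℝ J) (ht₀ : t₀ ∈ J)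
    (hs : γ t₀ ∈ e.source) (h : IsGeodesicNear F e' γ J t₀) :
    HasDerivWithinAt (fun s => e (γ s)) (derivWithin (fun s => e (γ s)) J t₀) J t₀ ∧
    HasDerivWithinAt (derivWithin (fun s => e (γ s)) J)
      (accel (sqInChart F e) (e (γ t₀), derivWithin (fun s => e (γ s)) J t₀)) J t₀ ∧
    derivWithin (fun s => e (γ s)) J t₀ ≠ 0 := by
  obtain ⟨v, a, h⟩ := h.change hF he he' ht₀ hs
  have hv : ∀ᶠ t in 𝓝[J] t₀, derivWithin (fun s => e (γ s)) J t = v t := by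
    filter_upwards [h, self_mem_nhdsWithin] with t ht htJ
    exact ht.2.1.derivWithin (hJ t htJ)
  have hv₀ := hv.self_of_nhdsWithin ht₀
  obtain ⟨h1, h2, h3, h4, h5⟩ := h.self_of_nhdsWithin ht₀
  have h6 := ((hF e he).eulerLagrange_iff (e.map_source h1) h4 _).1 h5
  rw [hv₀, ← h6]
  exact ⟨h2, h3.congr_of_eventuallyEq hv hv₀, h4⟩

omit [IsManifold 𝓘(ℝ, E) ∞ M] in
/-- A solution of the Euler--Lagrange equation in a chart is a geodesic. -/
theorem isGeodesicOn_symm_comp [FiniteDimensional ℝ E] {F : (x : M) → TangentSpace 𝓘(ℝ, E) x → ℝ}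
    (hF : IsFinslerInCharts F) {e : OpenPartialHomeomorph M E} (he : e ∈ atlas E M)
    {c w : ℝ → E} {J : Set ℝ} (hc : ∀ t ∈ J, c t ∈ e.target) (hw : ∀ t ∈ J, w t ≠ 0)
    (hc' : ∀ t ∈ J, HasDerivWithinAt c (w t) J t)
    (hw' : ∀ t ∈ J, HasDerivWithinAt w (accel (sqInChart F e) (c t, w t)) J t) :
    IsGeodesicOn F (fun t => e.symm (c t)) J := by
  refine Or.inr fun t₀ _ => ⟨e, he, w, fun t => accel (sqInChart F e) (c t, w t), ?_⟩
  filter_upwards [self_mem_nhdsWithin] with t ht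
  have h1 : ∀ s ∈ J, e (e.symm (c s)) = c s := fun s hs => e.right_inv (hc s hs)
  refine ⟨e.map_target (hc t ht), (hc' t ht).congr h1 (h1 t ht), hw' t ht, hw t ht, ?_⟩
  rw [h1 t ht]
  exact ((hF e he).eulerLagrange_iff (hc t ht) (hw t ht) _).2 rfl

/-- Local solutions of the Euler--Lagrange equation. -/
theorem exists_solution [FiniteDimensional ℝ E] {L : E → E → ℝ} {T : Set E}
    (hL : IsFinslerLagrangian L T) {u y : E} (hu : u ∈ T) (hy : y ≠ 0) :
    ∃ ε > 0, ∃ c w : ℝ → E, c 0 = u ∧ w 0 = y ∧ ∀ t ∈ Ioo (-ε) ε, c t ∈ T ∧ w t ≠ 0 ∧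
      HasDerivAt c (w t) t ∧ HasDerivAt w (accel L (c t, w t)) t := by
  have : CompleteSpace E := FiniteDimensional.complete ℝ E
  have hp : (u, y) ∈ T ×ˢ ({0}ᶜ : Set E) := ⟨hu, hy⟩
  have hX : LipschitzNear (fun p : E × E => (p.2, accel L p)) (u, y) :=
    (ContDiffAt.lipschitzNear contDiffAt_snd).prodMk (hL.lipschitzNear_accel hp)
  obtain ⟨ε, hε, α, hα0, hα⟩ := hX.exists_integralCurve
  have hcont : ContinuousAt α 0 := (hα 0 ⟨by linarith, hε⟩).continuousAt
  have hev : ∀ᶠ t in 𝓝 0, α t ∈ T ×ˢ ({0}ᶜ : Set E) :=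
    hcont.eventually (by rw [hα0]; exact hL.isOpen_prod.mem_nhds hp)
  obtain ⟨ε', hε', hball⟩ := Metric.mem_nhds_iff.1 hev
  refine ⟨min ε ε', lt_min hε hε', fun t => (α t).1, fun t => (α t).2, by simp [hα0],
    by simp [hα0], fun t ht => ?_⟩
  have h1 : t ∈ Ioo (-ε) ε :=
    ⟨by linarith [ht.1, min_le_left ε ε'], ht.2.trans_le (min_le_left _ _)⟩
  have h2 : α t ∈ T ×ˢ ({0}ᶜ : Set E) := by
    apply hball
    rw [Metric.mem_ball, Real.dist_eq, sub_zero, abs_lt]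
    exact ⟨by linarith [ht.1, min_le_right ε ε'], ht.2.trans_le (min_le_right _ _)⟩
  have h3 := hα t h1
  exact ⟨h2.1, h2.2, (ContinuousLinearMap.fst ℝ E E).hasFDerivAt.comp_hasDerivAt t h3,
    (ContinuousLinearMap.snd ℝ E E).hasFDerivAt.comp_hasDerivAt t h3⟩

end Velocity

/-! ### Defining functions in charts -/

section Boundary

variable {E : Type*} [NormedAddCommGroup E] [NormedSpace ℝ E]
  {M : Type*} [TopologicalSpace M] [ChartedSpace E M] [IsManifold 𝓘(ℝ, E) ∞ M]

omit [IsManifold 𝓘(ℝ, E) ∞ M] in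
theorem mfderiv_eq_fderiv_chartAt {φ : M → ℝ} {x : M} (h : MDifferentiableAt 𝓘(ℝ, E) 𝓘(ℝ, ℝ) φ x)
    (y : E) : mfderiv 𝓘(ℝ, E) 𝓘(ℝ, ℝ) φ x y =
      fderiv ℝ (fun u => φ ((chartAt E x).symm u)) (chartAt E x x) y := by
  have h2 : fderivWithin ℝ (writtenInExtChartAt 𝓘(ℝ, E) 𝓘(ℝ, ℝ) x φ) (range 𝓘(ℝ, E))
      (extChartAt 𝓘(ℝ, E) x x) = fderiv ℝ (fun u => φ ((chartAt E x).symm u)) (chartAt E x x) := by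
    simp only [modelWithCornersSelf_coe, range_id, fderivWithin_univ]
    rfl
  exact congrArg (fun l : E →L[ℝ] ℝ => l y) (h.mfderiv.trans h2)

namespace IsDefiningFunction

variable {D U : Set M} {φ : M → ℝ} (hφ : IsDefiningFunction E D U φ)
include hφ

omit [IsManifold 𝓘(ℝ, E) ∞ M] in
theorem contDiffAt_chart {e : OpenPartialHomeomorph M E} (he : e ∈ atlas E M) {u : E}
    (hu : u ∈ e.target) (hu' : e.symm u ∈ U) : ContDiffAt ℝ 2 (fun u => φ (e.symm u)) u :=
  (hφ.c21 e he).1.contDiffAt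
    ((e.isOpen_inter_preimage_symm hφ.isOpen).mem_nhds ⟨hu, hu'⟩)

omit [IsManifold 𝓘(ℝ, E) ∞ M] in
theorem lipschitzNear_chart {e : OpenPartialHomeomorph M E} (he : e ∈ atlas E M) {u : E}
    (hu : u ∈ e.target) (hu' : e.symm u ∈ U) :
    LipschitzNear (fderiv ℝ (fderiv ℝ (fun u => φ (e.symm u)))) u :=
  LocallyLipschitzOn.lipschitzNear (hφ.c21 e he).2
    (e.isOpen_inter_preimage_symm hφ.isOpen) ⟨hu, hu'⟩

/-- The differential of a defining function at a boundary point, computed in any chart. -/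
theorem mfderiv_apply {x : M} (hx : x ∈ U) (hxD : x ∈ frontier D) {e : OpenPartialHomeomorph M E}
    (he : e ∈ atlas E M) (hs : x ∈ e.source) (v : E) :
    mfderiv 𝓘(ℝ, E) 𝓘(ℝ, ℝ) φ x (fderiv ℝ (chartAt E x ∘ e.symm) (e x) v : E) =
      fderiv ℝ (fun u => φ (e.symm u)) (e x) v := by
  have hmd : MDifferentiableAt 𝓘(ℝ, E) 𝓘(ℝ, ℝ) φ x := by
    by_contra h
    exact hφ.regular x ⟨hx, hxD⟩ (mfderiv_zero_of_not_mdifferentiableAt h)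
  rw [mfderiv_eq_fderiv_chartAt hmd]
  set κ := chartAt E x
  have hκ : κ ∈ atlas E M := chart_mem_atlas E _
  have hκs : x ∈ κ.source := mem_chart_source E _
  have hpt : (κ ∘ e.symm) (e x) = κ x := by simp [e.left_inv hs]
  have h1 : DifferentiableAt ℝ (κ ∘ e.symm) (e x) :=
    (contDiffAt_transition hκ he (e.map_source hs) (by rwa [e.left_inv hs])).differentiableAt
      (by norm_num)
  have h2 : DifferentiableAt ℝ (fun u => φ (κ.symm u)) ((κ ∘ e.symm) (e x)) := by
    rw [hpt]
    exact (hφ.contDiffAt_chart hκ (κ.map_source hκs) (by rwa [κ.left_inv hκs])).differentiableAt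
      (by norm_num)
  have h3 : (fun u => φ (e.symm u)) =ᶠ[𝓝 (e x)] (fun u => φ (κ.symm u)) ∘ (κ ∘ e.symm) := by
    filter_upwards [eventually_mem_transition_source (e := κ) (e.map_source hs)
      (by rwa [e.left_inv hs])] with z hz
    simp [κ.left_inv hz.2]
  rw [h3.fderiv_eq, fderiv_comp _ h2 h1, hpt]
  rfl

theorem fderiv_chart_ne_zero {x : M} (hx : x ∈ U) (hxD : x ∈ frontier D)
    {e : OpenPartialHomeomorph M E} (he : e ∈ atlas E M) (hs : x ∈ e.source) :
    fderiv ℝ (fun u => φ (e.symm u)) (e x) ≠ 0 := by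
  intro h
  apply hφ.regular x ⟨hx, hxD⟩
  refine ContinuousLinearMap.ext fun y => ?_
  have h1 := hφ.mfderiv_apply hx hxD he hs (fderiv ℝ (e ∘ (chartAt E x).symm) (chartAt E x x) y)
  have h2 := fderiv_transition_comp (chart_mem_atlas E x) he (mem_chart_source E x) hs y
  have h3 : mfderiv 𝓘(ℝ, E) 𝓘(ℝ, ℝ) φ x (fderiv ℝ (chartAt E x ∘ e.symm) (e x)
      (fderiv ℝ (e ∘ (chartAt E x).symm) (chartAt E x x) y) : E) =
        mfderiv 𝓘(ℝ, E) 𝓘(ℝ, ℝ) φ x y :=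
    congrArg (fun z : E => mfderiv 𝓘(ℝ, E) 𝓘(ℝ, ℝ) φ x z) h2
  exact h3.symm.trans (h1.trans (by rw [h]; rfl))

omit [IsManifold 𝓘(ℝ, E) ∞ M] in
theorem chart_eq_zero {x : M} (hx : x ∈ U) (hxD : x ∈ frontier D)
    {e : OpenPartialHomeomorph M E} (hs : x ∈ e.source) : φ (e.symm (e x)) = 0 := by
  rw [e.left_inv hs]
  exact (hφ.eq_zero_iff x hx).2 hxD

omit [IsManifold 𝓘(ℝ, E) ∞ M] in
theorem eventually_chart_mem {x : M} (hx : x ∈ U) {e : OpenPartialHomeomorph M E}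
    (hs : x ∈ e.source) : ∀ᶠ u in 𝓝 (e x), u ∈ e.target ∧ e.symm u ∈ U :=
  (e.isOpen_inter_preimage_symm hφ.isOpen).mem_nhds
    ⟨e.map_source hs, by rwa [mem_preimage, e.left_inv hs]⟩

/-- Near a boundary point, the domain is the set where a defining function is positive. -/
theorem eventually_mem_of_pos {x : M} (hx : x ∈ U) (hxD : x ∈ frontier D)
    {e : OpenPartialHomeomorph M E} (he : e ∈ atlas E M) (hs : x ∈ e.source) :
    ∀ᶠ u in 𝓝 (e x), 0 < φ (e.symm u) → e.symm u ∈ D := by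
  have hmem := hφ.eventually_chart_mem hx hs
  have hfr := e.symm.preimage_frontier D
  have h0 := hmem.self_of_nhds
  have hcd := hφ.contDiffAt_chart he h0.1 h0.2
  refine FinslerConvexity.eventually_mem_of_pos (S := e.symm ⁻¹' D)
    (hcd.hasStrictFDerivAt (by norm_num)) (hφ.fderiv_chart_ne_zero hx hxD he hs) ?_ ?_ ?_
  · have h1 : e x ∈ e.symm.source ∩ e.symm ⁻¹' frontier D :=
      ⟨e.map_source hs, by rwa [mem_preimage, e.left_inv hs]⟩
    rw [hfr] at h1
    exact frontier_subset_closure h1.2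
  · filter_upwards [hmem] with u hu huD using hφ.pos _ ⟨hu.2, huD⟩
  · filter_upwards [hmem] with u hu huD
    have h1 : u ∈ e.symm.source ∩ frontier (e.symm ⁻¹' D) := ⟨hu.1, huD⟩
    rw [← hfr] at h1
    exact (hφ.eq_zero_iff _ hu.2).2 h1.2

end IsDefiningFunction

end Boundary

/-! ### Geodesics with positive Hessian enter the domain -/

section Convexity

variable {E : Type*} [NormedAddCommGroup E] [NormedSpace ℝ E] [FiniteDimensional ℝ E]
  {M : Type*} [TopologicalSpace M] [ChartedSpace E M] [IsManifold 𝓘(ℝ, E) ∞ M]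
  {F : (x : M) → TangentSpace 𝓘(ℝ, E) x → ℝ} {D U : Set M} {φ : M → ℝ}

omit [FiniteDimensional ℝ E] [IsManifold 𝓘(ℝ, E) ∞ M] in
theorem velocity_eq_of_chartAt {γ : ℝ → M} {J : Set ℝ} {t : ℝ} {x : M} {y : E} (hx : γ t = x)
    (hJ : UniqueDiffWithinAt ℝ J t) (hc : ContinuousWithinAt γ J t)
    (h : HasDerivWithinAt (fun s => chartAt E x (γ s)) y J t) : velocity E γ J t = ⟨x, y⟩ := by
  subst hx
  exact velocity_eq_of_hasDerivWithinAt hJ hc h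

omit [FiniteDimensional ℝ E] [IsManifold 𝓘(ℝ, E) ∞ M] in
theorem fderiv_chartAt_self (x : M) (v : E) :
    fderiv ℝ (chartAt E x ∘ (chartAt E x).symm) (chartAt E x x) v = v := by
  have h : chartAt E x ∘ (chartAt E x).symm =ᶠ[𝓝 (chartAt E x x)] id := by
    filter_upwards [(chartAt E x).open_target.mem_nhds (mem_chart_target E x)] with z hz
    exact (chartAt E x).right_inv hz
  rw [h.fderiv_eq, fderiv_id]
  rfl

/-- The first two derivatives of a defining function along a regular geodesic. -/
theorem IsDefiningFunction.hasDerivWithinAt_geodesic (hF : IsFinslerInCharts F)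
    (hφ : IsDefiningFunction E D U φ) {e e' : OpenPartialHomeomorph M E} (he : e ∈ atlas E M)
    (he' : e' ∈ atlas E M) {γ : ℝ → M} {J : Set ℝ} {t₀ : ℝ} (hJ : UniqueDiffOn ℝ J) (ht₀ : t₀ ∈ J)
    (hs : γ t₀ ∈ e.source) (hU : γ t₀ ∈ U) (h : IsGeodesicNear F e' γ J t₀) :
    HasDerivWithinAt (fun s => φ (γ s)) (fderiv ℝ (fun u => φ (e.symm u)) (e (γ t₀))
      (derivWithin (fun s => e (γ s)) J t₀)) J t₀ ∧
    HasDerivWithinAt (fun s => fderiv ℝ (fun u => φ (e.symm u)) (e (γ s))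
      (derivWithin (fun s => e (γ s)) J s))
      (hessianForm (sqInChart F e) (fun u => φ (e.symm u))
        (e (γ t₀), derivWithin (fun s => e (γ s)) J t₀)) J t₀ := by
  obtain ⟨h1, h2, h3⟩ := h.hasDerivWithinAt hF he he' hJ ht₀ hs
  have hcd := hφ.contDiffAt_chart he (e.map_source hs) (by rwa [e.left_inv hs])
  refine ⟨?_, hasDerivWithinAt_fderiv_curve (c := fun s => e (γ s)) hcd h1 h2⟩
  refine (hasDerivWithinAt_comp_curve (c := fun s => e (γ s)) hcd h1).congr_of_eventuallyEq ?_ ?_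
  · filter_upwards [(h.continuousWithinAt ht₀).eventually (e.open_source.mem_nhds hs)] with s hs'
    simp [e.left_inv hs']
  · simp [e.left_inv hs]

/-- The Finslerian Hessian, computed in any chart. -/
theorem IsHessian.eq_hessianForm (hF : IsFinslerInCharts F) (hφ : IsDefiningFunction E D U φ)
    {x : M} (hx : x ∈ U) {e : OpenPartialHomeomorph M E} (he : e ∈ atlas E M) (hs : x ∈ e.source)
    {v : E} (hv : v ≠ 0) {y : E} (hy : y = fderiv ℝ (chartAt E x ∘ e.symm) (e x) v) {h : ℝ}
    (hh : IsHessian F φ x y h) :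
    h = hessianForm (sqInChart F e) (fun u => φ (e.symm u)) (e x, v) := by
  have hinv := fderiv_transition_comp he (chart_mem_atlas E x) hs (mem_chart_source E x)
  have hy0 : y ≠ 0 := by
    rintro rfl
    apply hv
    rw [← hinv v, ← hy, map_zero]
  obtain ⟨ε, γ, hε, hγ, hvel, rfl⟩ := hh
  have h0 : (0 : ℝ) ∈ Ioo (-ε) ε := ⟨by linarith, hε⟩
  have hJ : UniqueDiffOn ℝ (Ioo (-ε) ε) := isOpen_Ioo.uniqueDiffOn
  rcases hγ with ⟨p, hp⟩ | hγ
  · rw [velocity_of_const h0 (hJ 0 h0) hp] at hvel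
    exact absurd (tangentBundle_mk_inj hvel).2.symm hy0
  have hnear : ∀ t ∈ Ioo (-ε) ε, ∃ e' ∈ atlas E M, IsGeodesicNear F e' γ (Ioo (-ε) ε) t := hγ
  obtain ⟨e₀, he₀, hn₀⟩ := hnear 0 h0
  have hc₀ := hn₀.continuousWithinAt h0
  have hγ0 : γ 0 = x := (tangentBundle_mk_inj hvel).1
  subst hγ0
  set w := derivWithin (fun s => e (γ s)) (Ioo (-ε) ε) with hw
  have hw0 : w 0 = v := by
    have h1 := (hn₀.hasDerivWithinAt hF he he₀ hJ h0 hs).1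
    rw [velocity_eq_of_chart he hs (hJ 0 h0) hc₀ h1] at hvel
    have h2 := (tangentBundle_mk_inj hvel).2
    rw [hy] at h2
    have h3 := congrArg (fderiv ℝ (e ∘ (chartAt E (γ 0)).symm) (chartAt E (γ 0) (γ 0))) h2
    rwa [hinv, hinv] at h3
  have hev : ∀ᶠ t in 𝓝 0, t ∈ Ioo (-ε) ε ∧ γ t ∈ e.source ∩ U := by
    have h1 := hc₀.eventually ((e.open_source.inter hφ.isOpen).mem_nhds ⟨hs, hx⟩)
    rw [isOpen_Ioo.nhdsWithin_eq h0] at h1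
    exact (isOpen_Ioo.eventually_mem h0).and h1
  have hd : deriv (fun s => φ (γ s)) =ᶠ[𝓝 0] fun t =>
      fderiv ℝ (fun u => φ (e.symm u)) (e (γ t)) (w t) := by
    filter_upwards [hev] with t ht
    obtain ⟨e₁, he₁, hn₁⟩ := hnear t ht.1
    exact ((hφ.hasDerivWithinAt_geodesic hF he he₁ hJ ht.1 ht.2.1 ht.2.2 hn₁).1.hasDerivAt
      (isOpen_Ioo.mem_nhds ht.1)).deriv
  rw [hd.deriv_eq, ((hφ.hasDerivWithinAt_geodesic hF he he₀ hJ h0 hs hx hn₀).2.hasDerivAt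
      (isOpen_Ioo.mem_nhds h0)).deriv, ← hw, hw0]

omit [IsManifold 𝓘(ℝ, E) ∞ M] in
/-- A solution of the Euler--Lagrange equation in the preferred chart, run at speed `k`, is a
geodesic with the expected initial velocity. -/
theorem isGeodesicOn_and_velocity (hF : IsFinslerInCharts F) {x : M} {c w : ℝ → E} {J I : Set ℝ}
    {k : ℝ} (hk : 0 < k) (hJ : UniqueDiffWithinAt ℝ J 0) (hJ0 : (0 : ℝ) ∈ J)
    (hJI : ∀ t ∈ J, k * t ∈ I) (hc0 : c 0 = chartAt E x x)
    (h : ∀ t ∈ I, c t ∈ (chartAt E x).target ∧ w t ≠ 0 ∧ HasDerivAt c (w t) t ∧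
      HasDerivAt w (accel (sqInChart F (chartAt E x)) (c t, w t)) t) :
    IsGeodesicOn F (fun t => (chartAt E x).symm (c (k * t))) J ∧
      velocity E (fun t => (chartAt E x).symm (c (k * t))) J 0 = ⟨x, k • w 0⟩ := by
  set e := chartAt E x
  have hL := hF e (chart_mem_atlas E x)
  have hlin : ∀ t, HasDerivAt (fun t => k * t) k t := fun t => by
    simpa using (hasDerivAt_id t).const_mul k
  have hd : ∀ t ∈ J, HasDerivAt (fun t => c (k * t)) (k • w (k * t)) t := fun t ht =>
    HasDerivAt.scomp t (h _ (hJI t ht)).2.2.1 (hlin t)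
  refine ⟨isGeodesicOn_symm_comp hF (chart_mem_atlas E x) (w := fun t => k • w (k * t))
    (fun t ht => (h _ (hJI t ht)).1) (fun t ht => smul_ne_zero hk.ne' (h _ (hJI t ht)).2.1)
    (fun t ht => (hd t ht).hasDerivWithinAt) fun t ht => ?_, ?_⟩
  · obtain ⟨h1, h2, h3, h4⟩ := h _ (hJI t ht)
    rw [hL.accel_smul h1 h2 hk, pow_two, ← smul_smul]
    exact ((HasDerivAt.scomp t h4 (hlin t)).const_smul k).hasDerivWithinAt
  · have ht : c (k * 0) ∈ e.target := (h _ (hJI 0 hJ0)).1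
    have h0 := (hd 0 hJ0).continuousAt
    have hc : ContinuousAt (fun t => e.symm (c (k * t))) 0 :=
      ContinuousAt.comp (g := e.symm) (f := fun t => c (k * t)) (e.continuousAt_symm ht) h0
    refine velocity_eq_of_chartAt ?_ hJ hc.continuousWithinAt ?_
    · simp only [mul_zero, hc0]
      exact e.left_inv (mem_chart_source E x)
    · have h1 := (hd 0 hJ0).hasDerivWithinAt (s := J)
      rw [mul_zero] at h1
      refine h1.congr_of_eventuallyEq ?_ (e.right_inv ht)
      filter_upwards [nhdsWithin_le_nhds (h0.eventually (e.open_target.mem_nhds ht))] with s hs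
      exact e.right_inv hs

/-- The Hessian exists, and is given by `hessianForm` in the preferred chart. -/
theorem isHessian_hessianForm (hF : IsFinslerInCharts F) (hφ : IsDefiningFunction E D U φ)
    {x : M} (hx : x ∈ U) {y : E} (hy : y ≠ 0) :
    IsHessian F φ x y (hessianForm (sqInChart F (chartAt E x))
      (fun u => φ ((chartAt E x).symm u)) (chartAt E x x, y)) := by
  obtain ⟨ε, hε, c, w, hc0, hw0, h⟩ :=
    exists_solution (hF _ (chart_mem_atlas E x)) (mem_chart_target E x) hy
  have h0 : (0 : ℝ) ∈ Ioo (-ε) ε := ⟨by linarith, hε⟩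
  obtain ⟨h1, h2⟩ := isGeodesicOn_and_velocity hF (J := Ioo (-ε) ε) one_pos
    (isOpen_Ioo.uniqueDiffOn 0 h0) h0 (fun t ht => by rwa [one_mul]) hc0 h
  rw [one_smul, hw0] at h2
  have h3 : IsHessian F φ x y _ := ⟨ε, _, hε, h1, h2, rfl⟩
  have h4 := h3.eq_hessianForm hF hφ hx (chart_mem_atlas E x) (mem_chart_source E x) hy
    (fderiv_chartAt_self x y).symm
  rwa [h4] at h3

/-- If the Hessian is positive on a tangent vector of the boundary, the geodesic with this initial
velocity lies in the domain except for its initial point. -/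
theorem exists_solution_mem_domain (hF : IsFinslerInCharts F) (hφ : IsDefiningFunction E D U φ)
    {x : M} (hx : x ∈ U) (hxD : x ∈ frontier D) {y : E} (hy : y ≠ 0)
    (hyt : y ∈ boundaryTangent E φ x)
    (hpos : 0 < hessianForm (sqInChart F (chartAt E x))
      (fun u => φ ((chartAt E x).symm u)) (chartAt E x x, y)) :
    ∃ ε > 0, ∃ c w : ℝ → E, c 0 = chartAt E x x ∧ w 0 = y ∧
      ∀ t ∈ Ioo (-ε) ε, (c t ∈ (chartAt E x).target ∧ w t ≠ 0 ∧ HasDerivAt c (w t) t ∧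
        HasDerivAt w (accel (sqInChart F (chartAt E x)) (c t, w t)) t) ∧
        (t ≠ 0 → (chartAt E x).symm (c t) ∈ D) := by
  set e := chartAt E x
  have he : e ∈ atlas E M := chart_mem_atlas E x
  have hs : x ∈ e.source := mem_chart_source E x
  obtain ⟨ε, hε, c, w, hc0, hw0, h⟩ := exists_solution (hF e he) (mem_chart_target E x) hy
  have hmem := hφ.eventually_chart_mem hx hs
  have h0 : (0 : ℝ) ∈ Ioo (-ε) ε := ⟨by linarith, hε⟩
  have hcont : ContinuousAt c 0 := (h 0 h0).2.2.1.continuousAt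
  have hev : ∀ᶠ t in 𝓝 0, t ∈ Ioo (-ε) ε ∧ (c t ∈ e.target ∧ e.symm (c t) ∈ U) ∧
      (0 < φ (e.symm (c t)) → e.symm (c t) ∈ D) :=
    (isOpen_Ioo.eventually_mem h0).and (hcont.eventually (by
      rw [hc0]; exact hmem.and (hφ.eventually_mem_of_pos hx hxD he hs)))
  have htan : fderiv ℝ (fun u => φ (e.symm u)) (e x) y = 0 := by
    rw [← hφ.mfderiv_apply hx hxD he hs, fderiv_chartAt_self]
    exact hyt
  have hcd0 := hφ.contDiffAt_chart he hmem.self_of_nhds.1 hmem.self_of_nhds.2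
  have hpos' : ∀ᶠ t in 𝓝[≠] 0, 0 < φ (e.symm (c t)) := by
    refine eventually_pos_of_second_deriv_pos (f := fun t => φ (e.symm (c t)))
      (p := fun t => fderiv ℝ (fun u => φ (e.symm u)) (c t) (w t)) ?_ ?_ ?_ ?_ hpos
    · filter_upwards [hev] with t ht
      have hcd := hφ.contDiffAt_chart he ht.2.1.1 ht.2.1.2
      rw [← hasDerivWithinAt_univ]
      exact hasDerivWithinAt_comp_curve hcd (h t ht.1).2.2.1.hasDerivWithinAt
    · rw [← hasDerivWithinAt_univ, ← hc0, ← hw0]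
      exact hasDerivWithinAt_fderiv_curve (by rwa [hc0]) (h 0 h0).2.2.1.hasDerivWithinAt
        (h 0 h0).2.2.2.hasDerivWithinAt
    · simp only [hc0]
      exact hφ.chart_eq_zero hx hxD hs
    · simp only [hc0, hw0]
      exact htan
  rw [eventually_nhdsWithin_iff] at hpos'
  obtain ⟨ε', hε', hball⟩ := Metric.mem_nhds_iff.1 (hev.and hpos')
  refine ⟨ε', hε', c, w, hc0, hw0, fun t ht => ?_⟩
  have ht' : t ∈ Metric.ball (0 : ℝ) ε' := by
    rw [Metric.mem_ball, Real.dist_eq, sub_zero, abs_lt]; exact ht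
  obtain ⟨⟨h1, h2, h3⟩, h4⟩ := hball ht'
  exact ⟨h t h1, fun hne => h3 (h4 hne)⟩

/-- A geodesic that leaves the boundary tangentially, with positive Hessian, into the domain both
forwards and backwards in time, is a geodesic of the closure that touches the boundary. -/
theorem infinitesimallyConvex_of_geometricallyConvex (hF : IsFinslerInCharts F) (hD : IsOpen D)
    (h : GeometricallyConvex F D) : InfinitesimallyConvex F D := by
  intro x hxD U φ hx hφ y hyt hy
  refine ⟨_, ?_, isHessian_hessianForm hF hφ hx hy⟩
  by_contra! hpos
  obtain ⟨ε, hε, c, w, hc0, hw0, hcw⟩ := exists_solution_mem_domain hF hφ hx hxD hy hyt hpos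
  have hxD' := notMem_of_mem_frontier hD hxD
  have hsub : ∀ t ∈ Icc (-(ε / 2)) (ε / 2), 1 * t ∈ Ioo (-ε) ε := fun t ht => by
    rw [one_mul]
    exact ⟨by linarith [ht.1], by linarith [ht.2]⟩
  have h0 : (0 : ℝ) ∈ Icc (-(ε / 2)) (ε / 2) := ⟨by linarith, by linarith⟩
  have hgeo := (isGeodesicOn_and_velocity hF one_pos
    (uniqueDiffOn_Icc (by linarith : -(ε / 2) < ε / 2) 0 h0) h0 hsub hc0
    fun t ht => (hcw t ht).1).1
  have hx0 : (chartAt E x).symm (c (1 * 0)) = x := by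
    rw [mul_zero, hc0, (chartAt E x).left_inv (mem_chart_source E x)]
  have hmem : ∀ t ∈ Icc (-(ε / 2)) (ε / 2), t ≠ 0 → (chartAt E x).symm (c (1 * t)) ∈ D :=
    fun t ht hne => (hcw _ (hsub t ht)).2 (by rwa [one_mul])
  apply hxD'
  rw [← hx0]
  refine h _ _ _ (by linarith) hgeo (fun t ht => ?_) (hmem _ ⟨le_rfl, by linarith⟩ (by linarith))
    (hmem _ ⟨by linarith, le_rfl⟩ (by linarith)) 0 h0
  rcases eq_or_ne t 0 with rfl | hne
  · rw [hx0]; exact frontier_subset_closure hxD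
  · exact subset_closure (hmem t ht hne)

/-- A geodesic with positive Hessian, run at low speed, shows that `exp` takes values in the domain
on every neighbourhood of `0` in the tangent space of the boundary. -/
theorem infinitesimallyConvex_of_forwardLocallyConvex (hF : IsFinslerInCharts F)
    (h : ForwardLocallyConvex F D) : InfinitesimallyConvex F D := by
  intro x hxD U φ hx hφ y hyt hy
  refine ⟨_, ?_, isHessian_hessianForm hF hφ hx hy⟩
  by_contra! hpos
  obtain ⟨ε, hε, c, w, hc0, hw0, hcw⟩ := exists_solution_mem_domain hF hφ hx hxD hy hyt hpos
  obtain ⟨N, hN, hNy⟩ := h x hxD U φ hx hφ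
  have hlim : Tendsto (fun k : ℝ => k • y) (𝓝[>] 0) (𝓝 0) := by
    have h1 : Continuous (fun k : ℝ => k • y) := continuous_id.smul continuous_const
    exact (h1.tendsto' 0 0 (zero_smul ℝ y)).mono_left nhdsWithin_le_nhds
  obtain ⟨k, hkN, hk0, hkε⟩ := ((hlim.eventually hN).and
    (Ioo_mem_nhdsGT hε : ∀ᶠ k in 𝓝[>] 0, k ∈ Ioo 0 ε)).exists
  have hsub : ∀ t ∈ Icc (0 : ℝ) 1, k * t ∈ Ioo (-ε) ε := fun t ht =>
    ⟨by nlinarith [ht.1], by nlinarith [ht.2]⟩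
  have h0 : (0 : ℝ) ∈ Icc (0 : ℝ) 1 := ⟨le_rfl, zero_le_one⟩
  obtain ⟨h1, h2⟩ := isGeodesicOn_and_velocity hF hk0
    (uniqueDiffOn_Icc (zero_lt_one' ℝ) 0 h0) h0 hsub hc0 fun t ht => (hcw t ht).1
  rw [hw0] at h2
  refine hNy (k • y) ⟨hkN, ?_⟩ _ ⟨_, h1, h2, rfl⟩ ((hcw _ (hsub 1 ⟨zero_le_one, le_rfl⟩)).2 ?_)
  · have h3 : mfderiv 𝓘(ℝ, E) 𝓘(ℝ, ℝ) φ x (k • y) = k • mfderiv 𝓘(ℝ, E) 𝓘(ℝ, ℝ) φ x y :=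
      map_smul _ _ _
    have h4 : mfderiv 𝓘(ℝ, E) 𝓘(ℝ, ℝ) φ x y = 0 := hyt
    exact h3.trans (by rw [h4, smul_zero])
  · rw [mul_one]; exact hk0.ne'

/-! ### Geodesics of an infinitesimally convex boundary -/

/-- The key estimate for the Hessian of a defining function of an infinitesimally convex
boundary. -/
theorem InfinitesimallyConvex.exists_hessianForm_le (hF : IsFinslerInCharts F)
    (h : InfinitesimallyConvex F D) (hφ : IsDefiningFunction E D U φ) {x : M} (hx : x ∈ U)
    (hxD : x ∈ frontier D) {e : OpenPartialHomeomorph M E} (he : e ∈ atlas E M)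
    (hs : x ∈ e.source) :
    ∃ C > 0, ∀ᶠ u in 𝓝 (e x), ∀ v, v ≠ 0 →
      hessianForm (sqInChart F e) (fun u => φ (e.symm u)) (u, v) ≤
        C * (|φ (e.symm u)| * ‖v‖ ^ 2 + |fderiv ℝ (fun u => φ (e.symm u)) u v| * ‖v‖) := by
  have hmem := hφ.eventually_chart_mem hx hs
  have h0 := hmem.self_of_nhds
  refine FinslerConvexity.exists_hessianForm_le (hF e he) (e.map_source hs)
    (hφ.contDiffAt_chart he h0.1 h0.2) (hφ.lipschitzNear_chart he h0.1 h0.2)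
    (hφ.chart_eq_zero hx hxD hs) (hφ.fderiv_chart_ne_zero hx hxD he hs) ?_
  filter_upwards [hmem] with u hu hu0 v hv hv0
  have hu' : e (e.symm u) = u := e.right_inv hu.1
  have hsu : e.symm u ∈ e.source := e.map_target hu.1
  have hfr := (hφ.eq_zero_iff _ hu.2).1 hu0
  have hinv := fderiv_transition_comp he (chart_mem_atlas E (e.symm u)) hsu
    (mem_chart_source E (e.symm u)) v
  obtain ⟨k, hk, hkH⟩ := h _ hfr U φ hu.2 hφ
    (fderiv ℝ (chartAt E (e.symm u) ∘ e.symm) (e (e.symm u)) v)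
    ((hφ.mfderiv_apply hu.2 hfr he hsu v).trans (by rw [hu']; exact hv0))
    (fun hz => hv (hinv.symm.trans ((congrArg (fun z : E =>
      fderiv ℝ (e ∘ (chartAt E (e.symm u)).symm) (chartAt E (e.symm u) (e.symm u)) z) hz).trans
        (map_zero _))))
  have h1 := hkH.eq_hessianForm hF hφ hu.2 he hsu hv rfl
  rw [hu'] at h1
  rwa [← h1]

/-- A regular geodesic that starts tangentially to the level set `{φ = 0}` does not enter
`{φ > 0}`, for a time that depends on the constant of the Hessian estimate and on a bound of the
velocity. -/
theorem IsDefiningFunction.comp_geodesic_nonpos (hF : IsFinslerInCharts F)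
    (hφ : IsDefiningFunction E D U φ) {e : OpenPartialHomeomorph M E} (he : e ∈ atlas E M)
    {γ : ℝ → M} {J : Set ℝ} (hJ : UniqueDiffOn ℝ J)
    (hγ : ∀ t ∈ J, ∃ e' ∈ atlas E M, IsGeodesicNear F e' γ J t) {t₀ t₁ C R : ℝ} (hC : 0 ≤ C)
    (hR : 0 ≤ R) (hsub : Icc t₀ t₁ ⊆ J)
    (hmem : ∀ t ∈ Icc t₀ t₁, (γ t ∈ e.source ∧ γ t ∈ U) ∧
      (∀ v, v ≠ 0 → hessianForm (sqInChart F e) (fun u => φ (e.symm u)) (e (γ t), v) ≤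
        C * (|φ (e.symm (e (γ t)))| * ‖v‖ ^ 2 +
          |fderiv ℝ (fun u => φ (e.symm u)) (e (γ t)) v| * ‖v‖)) ∧
      ‖derivWithin (fun s => e (γ s)) J t‖ ≤ R)
    (h0 : φ (γ t₀) = 0)
    (h0' : fderiv ℝ (fun u => φ (e.symm u)) (e (γ t₀)) (derivWithin (fun s => e (γ s)) J t₀) = 0)
    (hsmall : (C * R ^ 2 * (t₁ - t₀) + C * R) * (t₁ - t₀) < 1) {t : ℝ} (ht : t ∈ Icc t₀ t₁) :
    φ (γ t) ≤ 0 := by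
  set w := derivWithin (fun s => e (γ s)) J with hw
  refine nonpos_of_second_deriv_le (f := fun t => φ (γ t))
    (p := fun t => fderiv ℝ (fun u => φ (e.symm u)) (e (γ t)) (w t))
    (q := fun t => hessianForm (sqInChart F e) (fun u => φ (e.symm u)) (e (γ t), w t))
    (fun s hs => ?_) (fun s hs => ?_) h0 h0' (by positivity) (by positivity) (fun s hs => ?_)
    hsmall ht
  · obtain ⟨e', he', hn⟩ := hγ s (hsub hs)
    exact (hφ.hasDerivWithinAt_geodesic hF he he' hJ (hsub hs) (hmem s hs).1.1 (hmem s hs).1.2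
      hn).1.mono hsub
  · obtain ⟨e', he', hn⟩ := hγ s (hsub hs)
    exact (hφ.hasDerivWithinAt_geodesic hF he he' hJ (hsub hs) (hmem s hs).1.1 (hmem s hs).1.2
      hn).2.mono hsub
  · obtain ⟨e', he', hn⟩ := hγ s (hsub hs)
    obtain ⟨⟨hs1, -⟩, hs2, hs3⟩ := hmem s hs
    have h1 := hs2 (w s) (hn.hasDerivWithinAt hF he he' hJ (hsub hs) hs1).2.2
    rw [e.left_inv hs1] at h1
    calc _ ≤ C * (|φ (γ s)| * ‖w s‖ ^ 2 +
          |fderiv ℝ (fun u => φ (e.symm u)) (e (γ s)) (w s)| * ‖w s‖) := h1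
      _ ≤ C * (|φ (γ s)| * R ^ 2 + |fderiv ℝ (fun u => φ (e.symm u)) (e (γ s)) (w s)| * R) := by
        gcongr
      _ = _ := by ring

/-- At a time `t₀` at which a geodesic of the closure touches the boundary, `φ ∘ γ` has a minimum,
so that the geodesic stays in the boundary for some time. -/
theorem eventually_mem_frontier (hF : IsFinslerInCharts F) (h : InfinitesimallyConvex F D)
    (hφ : IsDefiningFunction E D U φ) {γ : ℝ → M} {a b t₀ : ℝ} (ht₀ : t₀ ∈ Ioo a b)
    (hγ : ∀ t ∈ Icc a b, ∃ e' ∈ atlas E M, IsGeodesicNear F e' γ (Icc a b) t)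
    (hcl : ∀ t ∈ Icc a b, γ t ∈ closure D) (hU : γ t₀ ∈ U) (hfr : γ t₀ ∈ frontier D) :
    ∀ᶠ t in 𝓝[>] t₀, γ t ∈ frontier D := by
  set e := chartAt E (γ t₀)
  have he : e ∈ atlas E M := chart_mem_atlas E _
  have hs : γ t₀ ∈ e.source := mem_chart_source E _
  have hJ : UniqueDiffOn ℝ (Icc a b) := uniqueDiffOn_Icc (ht₀.1.trans ht₀.2)
  have hJ0 : t₀ ∈ Icc a b := Ioo_subset_Icc_self ht₀
  have hnhds : Icc a b ∈ 𝓝 t₀ := Icc_mem_nhds ht₀.1 ht₀.2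
  set w := derivWithin (fun s => e (γ s)) (Icc a b) with hw
  obtain ⟨C, hC, hest⟩ := h.exists_hessianForm_le hF hφ hU hfr he hs
  obtain ⟨e', he', hn⟩ := hγ t₀ hJ0
  obtain ⟨hd1, hd2, -⟩ := hn.hasDerivWithinAt hF he he' hJ hJ0 hs
  have hcγ : ContinuousAt γ t₀ := (hn.continuousWithinAt hJ0).continuousAt hnhds
  have hcw : ContinuousAt w t₀ := hd2.continuousWithinAt.continuousAt hnhds
  have hce : ContinuousAt (fun s => e (γ s)) t₀ := hd1.continuousWithinAt.continuousAt hnhds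
  set R := ‖w t₀‖ + 1 with hR
  have hR0 : 0 ≤ R := by positivity
  have hsmall : ∀ᶠ t in 𝓝 t₀, (C * R ^ 2 * (t - t₀) + C * R) * (t - t₀) < 1 := by
    have h1 : Continuous fun t => (C * R ^ 2 * (t - t₀) + C * R) * (t - t₀) := by fun_prop
    exact h1.continuousAt.eventually_lt_const (by simp)
  have hgood := ((hcγ.eventually ((e.open_source.inter hφ.isOpen).mem_nhds ⟨hs, hU⟩)).and
    ((hce.eventually hest).and (hcw.norm.eventually_le_const (lt_add_one ‖w t₀‖)))).and
    (hsmall.and hnhds)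
  have hnonneg : ∀ t ∈ Icc a b, γ t ∈ U → 0 ≤ φ (γ t) := by
    intro t ht htU
    by_cases htD : γ t ∈ D
    · exact (hφ.pos _ ⟨htU, htD⟩).le
    · exact ((hφ.eq_zero_iff _ htU).2 ⟨hcl t ht, fun hi => htD (interior_subset hi)⟩).ge
  have hφ0 : φ (γ t₀) = 0 := (hφ.eq_zero_iff _ hU).2 hfr
  have hmin : IsLocalMin (fun t => φ (γ t)) t₀ := by
    filter_upwards [hgood] with t ht
    rw [hφ0]
    exact hnonneg t ht.2.2 ht.1.1.2
  have hslope := hmin.hasDerivAt_eq_zero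
    ((hφ.hasDerivWithinAt_geodesic hF he he' hJ hJ0 hs hU hn).1.hasDerivAt hnhds)
  obtain ⟨ε, hε, hball⟩ := Metric.mem_nhds_iff.1 hgood
  have hin : ∀ t, t₀ ≤ t → t < t₀ + ε → t ∈ Metric.ball t₀ ε := fun t h1 h2 => by
    rw [Metric.mem_ball, Real.dist_eq, abs_of_nonneg (by linarith)]
    linarith
  filter_upwards [Ioo_mem_nhdsGT (show t₀ < t₀ + ε by linarith)] with t ht
  have hsub : ∀ s ∈ Icc t₀ t, s ∈ Metric.ball t₀ ε := fun s hs =>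
    hin s hs.1 (hs.2.trans_lt ht.2)
  have htt : t ∈ Icc t₀ t := ⟨ht.1.le, le_rfl⟩
  have ht' := hball (hsub t htt)
  refine (hφ.eq_zero_iff _ ht'.1.1.2).1 (le_antisymm ?_ (hnonneg t ht'.2.2 ht'.1.1.2))
  exact hφ.comp_geodesic_nonpos hF he hJ hγ hC.le hR0 (fun s hs => (hball (hsub s hs)).2.2)
    (fun s hs => (hball (hsub s hs)).1) hφ0 hslope ht'.2.1 htt

/-- The set of times at which a geodesic of the closure is in the boundary is closed, and open to
the right; if it is not empty it contains the end of the interval. -/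
theorem geometricallyConvex_of_infinitesimallyConvex (hF : IsFinslerInCharts F)
    (hD : IsC21Domain E D) (h : InfinitesimallyConvex F D) : GeometricallyConvex F D := by
  intro a b γ hab hγ hcl ha hb t ht
  rcases hγ with ⟨p, hp⟩ | hγ
  · rw [hp t ht, ← hp a ⟨le_rfl, hab⟩]
    exact ha
  have hnear : ∀ t ∈ Icc a b, ∃ e' ∈ atlas E M, IsGeodesicNear F e' γ (Icc a b) t := hγ
  have hcont : ContinuousOn γ (Icc a b) := fun s hs => by
    obtain ⟨e', -, hn⟩ := hnear s hs
    exact hn.continuousWithinAt hs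
  by_contra htD
  have hsub : Icc t b ⊆ Icc a b := Icc_subset_Icc_left ht.1
  have hclosed : IsClosed ({s | γ s ∈ frontier D} ∩ Icc t b) := by
    rw [inter_comm]
    exact (hcont.mono hsub).preimage_isClosed_of_isClosed isClosed_Icc isClosed_frontier
  have hall := hclosed.Icc_subset_of_forall_mem_nhdsWithin
    ⟨hcl t ht, fun hi => htD (interior_subset hi)⟩ fun s hs => by
      obtain ⟨U, φ, hU, hφ⟩ := hD.exists_defining _ hs.1
      refine eventually_mem_frontier hF h hφ ⟨?_, hs.2.2⟩ hnear hcl hU hs.1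
      refine (ht.1.trans hs.2.1).lt_of_ne ?_
      rintro rfl
      exact notMem_of_mem_frontier hD.isOpen hs.1 ha
  exact notMem_of_mem_frontier hD.isOpen (hall ⟨ht.2, le_rfl⟩) hb

/-- A geodesic with small initial velocity `y` stays near its initial point up to time `1`, and its
velocity stays near `y`. -/
theorem exists_velocity_bound [T2Space M] (hF : IsFinslerInCharts F)
    {e : OpenPartialHomeomorph M E} (he : e ∈ atlas E M) {u₀ : E} {r C : ℝ} (hr : 0 < r)
    (hC : 0 < C) (hball : Metric.closedBall u₀ r ⊆ e.target)
    (hacc : ∀ u ∈ Metric.closedBall u₀ r, ∀ v, v ≠ 0 →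
      ‖accel (sqInChart F e) (u, v)‖ ≤ C * ‖v‖ ^ 2) {γ : ℝ → M}
    (hγ : ∀ t ∈ Icc (0 : ℝ) 1, ∃ e' ∈ atlas E M, IsGeodesicNear F e' γ (Icc 0 1) t)
    (hs : γ 0 ∈ e.source) (hu₀ : e (γ 0) = u₀)
    (hy : ‖derivWithin (fun s => e (γ s)) (Icc 0 1) 0‖ < min (r / 2) (1 / (8 * C))) :
    ∀ t ∈ Icc (0 : ℝ) 1, γ t ∈ e.source ∧ e (γ t) ∈ Metric.closedBall u₀ r ∧
      ‖derivWithin (fun s => e (γ s)) (Icc 0 1) t‖ ≤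
        2 * ‖derivWithin (fun s => e (γ s)) (Icc 0 1) 0‖ := by
  have hJ : UniqueDiffOn ℝ (Icc (0 : ℝ) 1) := uniqueDiffOn_Icc zero_lt_one
  have h00 : (0 : ℝ) ∈ Icc (0 : ℝ) 1 := ⟨le_rfl, zero_le_one⟩
  set w := derivWithin (fun s => e (γ s)) (Icc 0 1) with hw
  have hder : ∀ t ∈ Icc (0 : ℝ) 1, γ t ∈ e.source →
      HasDerivWithinAt (fun s => e (γ s)) (w t) (Icc 0 1) t ∧
      HasDerivWithinAt w (accel (sqInChart F e) (e (γ t), w t)) (Icc 0 1) t ∧ w t ≠ 0 := by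
    intro t ht hst
    obtain ⟨e', he', hn⟩ := hγ t ht
    exact hn.hasDerivWithinAt hF he he' hJ ht hst
  have hcont : ContinuousOn γ (Icc 0 1) := fun s hs => by
    obtain ⟨e', -, hn⟩ := hγ s hs
    exact hn.continuousWithinAt hs
  set y := w 0 with hy0
  have hypos : 0 < ‖y‖ := norm_pos_iff.2 (hder 0 h00 hs).2.2
  obtain ⟨hyr, hyC⟩ := lt_min_iff.1 hy
  rw [lt_div_iff₀ (by positivity)] at hyC
  set K := e.symm '' Metric.closedBall u₀ r with hK
  have hKc : IsClosed K :=
    ((isCompact_closedBall u₀ r).image_of_continuousOn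
      (e.continuousOn_symm.mono hball)).isClosed
  have hKmem : ∀ z, z ∈ K ↔ z ∈ e.source ∧ e z ∈ Metric.closedBall u₀ r := by
    refine fun z => ⟨?_, fun hz => ⟨e z, hz.2, e.left_inv hz.1⟩⟩
    rintro ⟨u, hu, rfl⟩
    exact ⟨e.map_target (hball hu), by rwa [e.right_inv (hball hu)]⟩
  set Q := {t | γ t ∈ K ∧ ‖w t - y‖ ≤ ‖y‖ / 2} with hQ
  have hw2 : ∀ t ∈ Q, ‖w t‖ ≤ 2 * ‖y‖ := fun t ht => by
    have h1 := norm_add_le (w t - y) y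
    rw [sub_add_cancel] at h1
    linarith [ht.2]
  have hQc : IsClosed (Q ∩ Icc 0 1) := by
    have h1 : IsClosed (Icc 0 1 ∩ γ ⁻¹' K) := hcont.preimage_isClosed_of_isClosed isClosed_Icc hKc
    have h2 : ContinuousOn (fun t => ‖w t - y‖) (Icc 0 1 ∩ γ ⁻¹' K) := fun t ht =>
      (((hder t ht.1 ((hKmem _).1 ht.2).1).2.1.continuousWithinAt.mono inter_subset_left).sub
        continuousWithinAt_const).norm
    have h3 := h2.preimage_isClosed_of_isClosed h1 (isClosed_Iic (a := ‖y‖ / 2))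
    convert h3 using 1
    ext t
    simp only [hQ, mem_inter_iff, mem_ofPred_eq, mem_preimage, mem_Iic]
    tauto
  have h0Q : (0 : ℝ) ∈ Q := by
    refine ⟨(hKmem _).2 ⟨hs, ?_⟩, ?_⟩
    · rw [hu₀]; exact Metric.mem_closedBall_self hr.le
    · rw [← hy0, sub_self, norm_zero]; positivity
  have hmain := Icc_subset_of_forall_Icc_subset hQc h0Q fun t ht hsub => by
    have ht1 : t ∈ Icc (0 : ℝ) 1 := Ico_subset_Icc_self ht
    have hsub1 : Icc 0 t ⊆ Icc (0 : ℝ) 1 := Icc_subset_Icc_right ht1.2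
    have htt : t ∈ Icc 0 t := ⟨ht1.1, le_rfl⟩
    have h0t : (0 : ℝ) ∈ Icc 0 t := ⟨le_rfl, ht1.1⟩
    have hsrc := ((hKmem _).1 (hsub htt).1).1
    -- both inequalities that define `Q` are strict at time `t`
    have e1 : ‖e (γ t) - e (γ 0)‖ ≤ 2 * ‖y‖ * ‖t - 0‖ :=
      (convex_Icc 0 t).norm_image_sub_le_of_norm_hasDerivWithin_le
        (f := fun s => e (γ s)) (f' := w)
        (fun s hs => (hder s (hsub1 hs) ((hKmem _).1 (hsub hs).1).1).1.mono hsub1)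
        (fun s hs => hw2 s (hsub hs)) h0t htt
    have e2 : ‖w t - w 0‖ ≤ C * (2 * ‖y‖) ^ 2 * ‖t - 0‖ :=
      (convex_Icc 0 t).norm_image_sub_le_of_norm_hasDerivWithin_le
        (f' := fun s => accel (sqInChart F e) (e (γ s), w s))
        (fun s hs => (hder s (hsub1 hs) ((hKmem _).1 (hsub hs).1).1).2.1.mono hsub1)
        (fun s hs => by
          obtain ⟨h1, h2⟩ := (hKmem _).1 (hsub hs).1
          refine (hacc _ h2 _ (hder s (hsub1 hs) h1).2.2).trans ?_
          gcongr
          exact hw2 s (hsub hs)) h0t htt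
    rw [sub_zero, Real.norm_eq_abs, abs_of_nonneg ht1.1] at e1 e2
    have e1' : ‖e (γ t) - u₀‖ < r := by
      rw [hu₀] at e1
      nlinarith [ht1.2]
    have e2' : ‖w t - y‖ < ‖y‖ / 2 := by
      have h1 : C * (2 * ‖y‖) ^ 2 * t ≤ C * (2 * ‖y‖) ^ 2 * 1 := by gcongr; exact ht1.2
      have h2 : C * (2 * ‖y‖) ^ 2 * 1 = ‖y‖ * (8 * C) * (‖y‖ / 2) := by ring
      nlinarith
    obtain ⟨hd1, hd2, -⟩ := hder t ht1 hsrc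
    have hev : ∀ᶠ s in 𝓝[Icc 0 1] t, s ∈ Q := by
      filter_upwards [(hcont t ht1).eventually (e.open_source.mem_nhds hsrc),
        (hd1.continuousWithinAt.sub continuousWithinAt_const).norm.eventually_le_const e1',
        (hd2.continuousWithinAt.sub continuousWithinAt_const).norm.eventually_le_const e2']
        with s h1 h2 h3
      exact ⟨(hKmem _).2 ⟨h1, by rwa [Metric.mem_closedBall, dist_eq_norm]⟩, h3⟩
    exact nhdsWithin_le_of_mem (Icc_mem_nhdsGT_of_mem ht) hev
  exact fun t ht => ⟨((hKmem _).1 (hmain ht).1).1, ((hKmem _).1 (hmain ht).1).2,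
    hw2 t (hmain ht)⟩

/-- Geodesics with small initial velocity tangent to the boundary stay in the region of the Hessian
estimate up to time `1`, and the differential inequality keeps them out of `{φ > 0}`. -/
theorem forwardLocallyConvex_of_infinitesimallyConvex [T2Space M] (hF : IsFinslerInCharts F)
    (hD : IsOpen D) (h : InfinitesimallyConvex F D) : ForwardLocallyConvex F D := by
  intro x hxD U φ hx hφ
  set e := chartAt E x
  have he : e ∈ atlas E M := chart_mem_atlas E x
  have hs : x ∈ e.source := mem_chart_source E x
  obtain ⟨C₁, hC₁, hest⟩ := h.exists_hessianForm_le hF hφ hx hxD he hs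
  obtain ⟨C₂, hC₂, hacc⟩ := exists_norm_accel_le (hF e he) (e.map_source hs)
  obtain ⟨r, hr, hball⟩ := Metric.nhds_basis_closedBall.mem_iff.1
    ((hφ.eventually_chart_mem hx hs).and (hest.and hacc))
  -- the bounds on the velocity `y` under which the geodesic stays in the ball of radius `r`, and
  -- `nonpos_of_second_deriv_le` applies up to time `1`
  set η : ℝ := min (min (r / 2) (1 / (8 * C₂))) (min 1 (1 / (6 * C₁))) with hη
  have hη0 : 0 < η := by positivity
  obtain ⟨N, hN, hNη⟩ : ∃ N ∈ 𝓝 (0 : E), ∀ y ∈ N, ‖y‖ < η :=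
    ⟨Metric.ball 0 η, Metric.ball_mem_nhds 0 hη0, fun y hy => mem_ball_zero_iff.1 hy⟩
  suffices key : ∀ y : E, ‖y‖ < η → y ∈ boundaryTangent E φ x → ∀ q, IsExp F x y q → q ∉ D from
    ⟨N, hN, fun y hy => key y (hNη y hy.1) hy.2⟩
  rintro y hyn hyt _ ⟨γ, hγ, hvel, rfl⟩
  have h0 : (0 : ℝ) ∈ Icc (0 : ℝ) 1 := ⟨le_rfl, zero_le_one⟩
  have h1 : (1 : ℝ) ∈ Icc (0 : ℝ) 1 := ⟨zero_le_one, le_rfl⟩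
  have hJ : UniqueDiffOn ℝ (Icc (0 : ℝ) 1) := uniqueDiffOn_Icc zero_lt_one
  have hγ0 : γ 0 = x := (tangentBundle_mk_inj hvel).1
  rcases hγ with ⟨p, hp⟩ | hγ
  · rw [hp 1 h1, ← hp 0 h0, hγ0]
    exact notMem_of_mem_frontier hD hxD
  have hnear : ∀ t ∈ Icc (0 : ℝ) 1, ∃ e' ∈ atlas E M, IsGeodesicNear F e' γ (Icc 0 1) t := hγ
  have hs0 : γ 0 ∈ e.source := by rwa [hγ0]
  have hw0 : derivWithin (fun s => e (γ s)) (Icc 0 1) 0 = y := by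
    obtain ⟨e', he', hn⟩ := hnear 0 h0
    have h2 := (hn.hasDerivWithinAt hF he he' hJ h0 hs0).1
    have h3 := velocity_eq_of_chartAt hγ0 (hJ 0 h0) (hn.continuousWithinAt h0) h2
    exact (tangentBundle_mk_inj (h3.symm.trans hvel)).2
  have hbd := exists_velocity_bound hF he hr hC₂ (fun u hu => (hball hu).1.1)
    (fun u hu => (hball hu).2.2) hnear hs0 (by rw [hγ0])
    (by rw [hw0]; exact hyn.trans_le (min_le_left _ _))
  rw [hw0] at hbd
  have hU : ∀ t ∈ Icc (0 : ℝ) 1, γ t ∈ U := fun t ht => by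
    have h2 := (hball (hbd t ht).2.1).1.2
    rwa [e.left_inv (hbd t ht).1] at h2
  have htan : fderiv ℝ (fun u => φ (e.symm u)) (e x) y = 0 := by
    rw [← hφ.mfderiv_apply hx hxD he hs, fderiv_chartAt_self]
    exact hyt
  have hle : φ (γ 1) ≤ 0 := by
    refine hφ.comp_geodesic_nonpos hF he hJ hnear (C := C₁) (R := 2 * ‖y‖) hC₁.le
      (by positivity) subset_rfl (fun t ht => ⟨⟨(hbd t ht).1, hU t ht⟩,
        (hball (hbd t ht).2.1).2.1, (hbd t ht).2.2⟩) ?_ ?_ ?_ h1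
    · rw [hγ0]; exact (hφ.eq_zero_iff x hx).2 hxD
    · rw [hγ0, hw0]; exact htan
    · have h2 : ‖y‖ < 1 := hyn.trans_le ((min_le_right _ _).trans (min_le_left _ _))
      have h3 : ‖y‖ < 1 / (6 * C₁) :=
        hyn.trans_le ((min_le_right _ _).trans (min_le_right _ _))
      rw [lt_div_iff₀ (by positivity)] at h3
      have h4 : C₁ * ‖y‖ ^ 2 ≤ C₁ * ‖y‖ := by
        gcongr
        nlinarith [norm_nonneg (y : E)]
      nlinarith
  exact fun hq => (hφ.pos _ ⟨hU 1 h1, hq⟩).not_ge hle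

omit [IsManifold 𝓘(ℝ, E) ∞ M] in
/-- The geodesic of the reversed metric with initial velocity `v` is the geodesic of `F` with
initial velocity `-v`, run backwards. -/
theorem hessianForm_reversed (hF : IsFinslerInCharts F) {e : OpenPartialHomeomorph M E}
    (he : e ∈ atlas E M) {u v : E} (hu : u ∈ e.target) (hv : v ≠ 0) (ψ : E → ℝ) :
    hessianForm (sqInChart (reversed F) e) ψ (u, v) = hessianForm (sqInChart F e) ψ (u, -v) := by
  have h1 : accel (sqInChart (reversed F) e) (u, v) = accel (sqInChart F e) (u, -v) := by
    refine ((hF e he).eulerLagrange_iff hu (neg_ne_zero.2 hv) _).1 ?_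
    have h2 := ((hF.reversed e he).eulerLagrange_iff hu hv _).2 rfl
    rwa [sqInChart_reversed, eulerLagrange_reverse, ← sqInChart_reversed] at h2
  simp [hessianForm, h1]

/-- Infinitesimal convexity does not see the orientation of geodesics. -/
theorem InfinitesimallyConvex.reversed (hF : IsFinslerInCharts F)
    (h : InfinitesimallyConvex F D) : InfinitesimallyConvex (reversed F) D := by
  intro x hxD U φ hx hφ y hyt hy
  have hy' : -y ∈ boundaryTangent E φ x := by
    have h1 : mfderiv 𝓘(ℝ, E) 𝓘(ℝ, ℝ) φ x (-y) = -mfderiv 𝓘(ℝ, E) 𝓘(ℝ, ℝ) φ x y := map_neg _ _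
    have h2 : mfderiv 𝓘(ℝ, E) 𝓘(ℝ, ℝ) φ x y = 0 := hyt
    exact h1.trans (by rw [h2, neg_zero])
  have hyE : (-y : E) ≠ 0 := neg_ne_zero.2 hy
  obtain ⟨k, hk, hkH⟩ := h x hxD U φ hx hφ (-y) hy' hyE
  refine ⟨_, ?_, isHessian_hessianForm hF.reversed hφ hx hy⟩
  rw [hessianForm_reversed hF (chart_mem_atlas E x) (mem_chart_target E x) hy]
  have h1 := hkH.eq_hessianForm hF hφ hx (chart_mem_atlas E x) (mem_chart_source E x) hyE
    (fderiv_chartAt_self x _).symm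
  exact h1 ▸ hk

end Convexity

end FinslerConvexity

end

theorem mainTheorem2 {E : Type*} [NormedAddCommGroup E] [NormedSpace ℝ E]
    [FiniteDimensional ℝ E] {M : Type*} [TopologicalSpace M] [T2Space M]
    [SecondCountableTopology M] [ChartedSpace E M] [IsManifold 𝓘(ℝ, E) ∞ M]
    (F : (x : M) → TangentSpace 𝓘(ℝ, E) x → ℝ) (hF : FinslerConvexity.IsFinslerMetric F)
    (D : Set M) (hD : FinslerConvexity.IsC21Domain E D) :
    List.TFAE [FinslerConvexity.InfinitesimallyConvex F D,
      FinslerConvexity.GeometricallyConvex F D,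
      FinslerConvexity.LocallyConvex F D,
      FinslerConvexity.ForwardLocallyConvex F D] := by
  have hF' := hF.isFinslerInCharts
  tfae_have 1 → 2 := FinslerConvexity.geometricallyConvex_of_infinitesimallyConvex hF' hD
  tfae_have 2 → 1 := FinslerConvexity.infinitesimallyConvex_of_geometricallyConvex hF' hD.isOpen
  tfae_have 1 → 3 := fun h =>
    ⟨FinslerConvexity.forwardLocallyConvex_of_infinitesimallyConvex hF' hD.isOpen h,
      FinslerConvexity.forwardLocallyConvex_of_infinitesimallyConvex hF'.reversed hD.isOpen
        (h.reversed hF')⟩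
  tfae_have 3 → 4 := fun h => h.1
  tfae_have 4 → 1 := FinslerConvexity.infinitesimallyConvex_of_forwardLocallyConvex hF'
  tfae_finish
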